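/- Let $\mathbb K$ be an algebraically closed field of characteristic zero, $\mathfrak a=\langle f_1,\dots,f_s\rangle\subseteq\mathbb K[T_1,\dots,T_r]$ an ideal and $\gamma_0$ a face of the orthant $\gamma=\mathbb Q_{\ge 0}^r$. Put $J=\{i;\ e_i\in\gamma_0\}$, let $\mathbb T^r_{\gamma_0}\subseteq\mathbb K^r$ be the torus orbit of all $x$ with $x_i\neq 0\Leftrightarrow i\in J$, regarded as the torus $(\mathbb K^*)^J$, and for a polynomial $f$ let $f_{\gamma_0}\in\mathbb K[T_i;\ i\in J]$ arise by replacing each $T_i$, $i\notin J$, with $0$. Call $\gamma_0$ an $\mathfrak a$-face if $V(\mathbb T^r_{\gamma_0};\mathfrak a)\ne\emptyset$. Set $g_i=(f_i)_{\gamma_0}$, let $\mathfrak c\subseteq\mathcal O(\mathbb T^r_{\gamma_0})$ be the ideal generated by all $f_{\gamma_0}$, $f\in\mathfrak a$, and let $H(\gamma_0)\subseteq\mathbb T^r_{\gamma_0}$ be the maximal subgroup leaving $V=V(\mathbb T^r_{\gamma_0};\mathfrak c)$ invariant. An integral $n\times J$ matrix $P$ defines $\pi\colon\mathbb T^r_{\gamma_0}\to\mathbb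 T^n$, $t\mapsto(t^{P_{1*}},\dots,t^{P_{n*}})$. A push-forward of $g\in\mathcal O(\mathbb T^r_{\gamma_0})$ under $\pi$ is an $h\in\mathcal O(\mathbb T^n)$ with $\pi^*h=T^\mu g$ for some Laurent monomial $T^\mu$; let $\pi_*\mathfrak c$ be the ideal generated by all push-forwards of elements of $\mathfrak c$. (i) There is a $P$ of full row rank with $\ker\pi=H(\gamma_0)$, so that $\pi$ is the quotient map $\mathbb T^r_{\gamma_0}\to\mathbb T^r_{\gamma_0}/H(\gamma_0)\cong\mathbb T^n$. For every such $P$ we have $\pi(V)=V(\mathbb T^n;\pi_*\mathfrak c)$; in particular $\gamma_0$ is an $\mathfrak a$-face if and only if $V(\mathbb T^n;\pi_*\mathfrak c)\neq\emptyset$. If moreover $h_1,\dots,h_s\in\mathbb K[T_1,\dots,T_n]$ are push-forwards of $g_1,\dots,g_s$, then $\pi(V)=V(\mathbb T^n;h_1,\dots,h_s)$, and $$\gamma_0\text{ is an }\mathfrak a\text{-face}\iff V(\mathbb T^n;h_1,\dots,h_s)\ne\emptyset\iff T_1\cdots T_n\notin\sqrt{\langle h_1,\dots,h_s\rangle}.$$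 (ii) (The algorithm.) For $g=a_0T^{\nu_0}+\dots+a_mT^{\nu_m}$ with pairwise different exponents and $a_j\ne0$, let $P_g$ be the matrix with rows $\nu_1-\nu_0,\dots,\nu_m-\nu_0$ (no rows if $g=0$), and let $P_G$ be the vertical concatenation of $P_{g_1},\dots,P_{g_s}$. A Hermite normal form $D=U\cdot P_G$ with $U$ unimodular exists. For any such $D$, let $P$ be the matrix of its upper, non-zero rows and $n$ their number. Then $P$ has full row rank; $\ker\pi$ consists of exactly those $t$ for which each $g_i$ is semi-invariant under translation by $t$ (i.e. $\ker\pi$ is the largest subgroup with respect to which all $g_i$ are homogeneous); $\ker\pi\subseteq H(\gamma_0)$; and $\ker\pi=H(\gamma_0)$ if all $g_i$ are $H(\gamma_0)$-homogeneous. A Smith normal form $D'=U'\cdot P\cdot V'$ with $U',V'$ unimodular and a rational section $\sigma$ of $D'$ (i.e. $D'\sigma=E_n$) exist. For any such choice, all $B_i:=P_{g_i}\cdot V'\cdot\sigma\cdot U'$ are integral, and there are $\mu_i\in\mathbb Z_{\ge0}^n$ such that, writing $a_{ij}$ for the coefficients of $g_i$, $$\pi_*g_i:=T^{\mu_i}\bigl(a_{i0}+a_{i1}T^{(B_i)_{1*}}+\dots+a_{im_i}T^{(B_i)_{m_i*}}\bigr)\in\mathbb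 K[T_1,\dots,T_n]$$ (with $\pi_*g_i:=0$ if $g_i=0$). For any such $\mu_i$ each $\pi_*g_i$ is a push-forward of $g_i$ under $\pi$, $\pi(V)=V(\mathbb T^n;\pi_*g_1,\dots,\pi_*g_s)$, and $$\gamma_0\text{ is an }\mathfrak a\text{-face}\iff V(\mathbb T^n;\pi_*g_1,\dots,\pi_*g_s)\neq\emptyset\iff T_1\cdots T_n\notin\sqrt{\langle\pi_*g_1,\dots,\pi_*g_s\rangle}.$$ -/

import Mathlib

noncomputable section

namespace GITFan

/-! ### Tori, Laurent polynomials and integral matrices -/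

/-- The torus `(K^*)^ι`. -/
abbrev Torus (K : Type*) [Field K] (ι : Type*) : Type _ := ι → Kˣ

/-- The ring `𝒪((K^*)^ι)` of Laurent polynomials in variables indexed by `ι`. -/
abbrev Laurent (K : Type*) [Field K] (ι : Type*) : Type _ := AddMonoidAlgebra K (ι → ℤ)

/-- The value `t^ν = ∏ i, t_i ^ ν_i` of a character at a point of the torus. -/
def Torus.chi {K ι : Type*} [Field K] [Fintype ι] (t : Torus K ι) (ν : ι → ℤ) : Kˣ :=
  ∏ i, t i ^ ν i

/-- Evaluation of Laurent polynomials at a point of the torus. -/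
def Laurent.eval {K ι : Type*} [Field K] [Fintype ι] (t : Torus K ι) : Laurent K ι →ₐ[K] K :=
  AddMonoidAlgebra.lift K K (ι → ℤ)
    { toFun := fun m => ((t.chi m.toAdd : Kˣ) : K)
      map_one' := by simp [Torus.chi]
      map_mul' := fun a b => by simp [Torus.chi, zpow_add, Finset.prod_mul_distrib] }

/-- The inclusion of the polynomial ring into the Laurent polynomial ring. -/
def toLaurent {K ι : Type*} [Field K] [DecidableEq ι] : MvPolynomial ι K →ₐ[K] Laurent K ι :=
  MvPolynomial.aeval fun i => AddMonoidAlgebra.single (Pi.single i 1) 1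

/-- The zero set `V(T; 𝔠)` of an ideal of Laurent polynomials in the torus. -/
def torusZeros {K ι : Type*} [Field K] [Fintype ι] (𝔠 : Ideal (Laurent K ι)) :
    Set (Torus K ι) :=
  {t | ∀ g ∈ 𝔠, Laurent.eval t g = 0}

/-- The zero set `V(T; h_1, …, h_s)` of a tuple of polynomials in the torus. -/
def torusZerosPoly {K ι κ : Type*} [Field K] (h : κ → MvPolynomial ι K) : Set (Torus K ι) :=
  {t | ∀ i, MvPolynomial.eval (fun j => (t j : K)) (h i) = 0}

/-- The homomorphism of tori `t ↦ (t^{A_{1*}}, …, t^{A_{n*}})` given by an integral matrix. -/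
def torusHom (K : Type*) [Field K] {ι κ : Type*} [Fintype ι] (A : Matrix κ ι ℤ) :
    Torus K ι →* Torus K κ where
  toFun t := fun j => t.chi (A j)
  map_one' := by funext j; simp [Torus.chi]
  map_mul' a b := by funext j; simp [Torus.chi, mul_zpow, Finset.prod_mul_distrib]

/-- The comorphism of `torusHom K A`: the monomial `T^m` is sent to `T^{m A}`. -/
def pullback (K : Type*) [Field K] {ι κ : Type*} [Fintype κ] (A : Matrix κ ι ℤ) :
    Laurent K κ →ₐ[K] Laurent K ι :=
  AddMonoidAlgebra.mapDomainAlgHom K K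
    ({ toFun := fun m => Matrix.vecMul m A
       map_zero' := Matrix.zero_vecMul A
       map_add' := fun a b => Matrix.add_vecMul A a b } : (κ → ℤ) →+ (ι → ℤ))

/-- The maximal subgroup of the torus that leaves `V(T; 𝔠)` invariant. -/
def maxInvariantSubgroup {K ι : Type*} [Field K] [Fintype ι] (𝔠 : Ideal (Laurent K ι)) :
    Subgroup (Torus K ι) :=
  open scoped Pointwise in MulAction.stabilizer (Torus K ι) (torusZeros 𝔠)

/-- The integral matrix `P` describes the quotient map `(K^*)^ι → (K^*)^ι / H ≅ (K^*)^n`: it has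
full rank and the homomorphism that it defines has kernel `H`. -/
structure DescribesQuotient {K ι : Type*} [Field K] [Fintype ι] {n : ℕ}
    (P : Matrix (Fin n) ι ℤ) (H : Subgroup (Torus K ι)) : Prop where
  full_rank : LinearIndependent ℤ P.row
  ker_eq : (torusHom K P).ker = H

/-- `h` is a push-forward of `g`: `π^* h = T^μ g` for some monomial `T^μ`. -/
def IsPushForward {K ι κ : Type*} [Field K] [Fintype κ] (P : Matrix κ ι ℤ)
    (g : Laurent K ι) (h : Laurent K κ) : Prop :=
  ∃ μ : ι → ℤ, pullback K P h = AddMonoidAlgebra.single μ 1 * g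

/-- The ideal `π_* 𝔠` generated by all push-forwards of elements of `𝔠`. -/
def pushIdeal {K ι κ : Type*} [Field K] [Fintype κ] (P : Matrix κ ι ℤ)
    (𝔠 : Ideal (Laurent K ι)) : Ideal (Laurent K κ) :=
  Ideal.span {h | ∃ g ∈ 𝔠, IsPushForward P g h}

/-- `g(t x) = c g(x)` on the torus for some constant `c ≠ 0`. The function `g` is homogeneous with
respect to a subgroup if and only if this holds for all `t` in the subgroup. -/
def IsSemiInvariant {K ι : Type*} [Field K] [Fintype ι] (t : Torus K ι) (g : Laurent K ι) : Prop :=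
  ∃ c : Kˣ, ∀ x : Torus K ι, Laurent.eval (t * x) g = c * Laurent.eval x g

/-! ### Exponent matrices and normal forms -/

/-- `ν` lists the exponents `ν_0, …, ν_m` of the terms of `g`, without repetition. It is empty
if `g = 0`. -/
def IsTermList {K ι : Type*} [Field K] (g : Laurent K ι) (ν : List (ι → ℤ)) : Prop :=
  ν.Nodup ∧ ∀ m, m ∈ ν ↔ g.coeff m ≠ 0

/-- The matrix `P_g` with rows `ν_1 - ν_0, …, ν_m - ν_0`. -/
def diffMatrix {ι : Type*} (ν : List (ι → ℤ)) : Matrix (Fin (ν.length - 1)) ι ℤ :=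
  Matrix.of fun (j : Fin (ν.length - 1)) =>
    ν.get ⟨j.val + 1, by omega⟩ - ν.get ⟨0, by have := j.isLt; omega⟩

/-- The number of rows of the matrix `P_G`. -/
abbrev rowCount {ι : Type*} {s : ℕ} (ν : Fin s → List (ι → ℤ)) : ℕ := ∑ i, ((ν i).length - 1)

/-- The vertical concatenation `P_G` of `P_{g_1}, …, P_{g_s}`. -/
def stackMatrix {ι : Type*} {s : ℕ} (ν : Fin s → List (ι → ℤ)) :
    Matrix (Fin (rowCount ν)) ι ℤ :=
  Matrix.of fun a =>
    diffMatrix (ν (finSigmaFinEquiv.symm a).1) (finSigmaFinEquiv.symm a).2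

/-- `D` is in (row) Hermite normal form and its non-zero rows are the upper `n` ones. -/
structure IsHermiteNormalForm {ι : Type*} [LinearOrder ι] {N n : ℕ} (hn : n ≤ N)
    (D : Matrix (Fin N) ι ℤ) : Prop where
  lower_rows_zero : ∀ a : Fin N, n ≤ a.val → ∀ j, D a j = 0
  echelon : ∃ p : Fin n → ι, StrictMono p ∧ ∀ a : Fin n,
    0 < D (Fin.castLE hn a) (p a) ∧
    (∀ j, j < p a → D (Fin.castLE hn a) j = 0) ∧
    ∀ b, b < a → 0 ≤ D (Fin.castLE hn b) (p a) ∧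
      D (Fin.castLE hn b) (p a) < D (Fin.castLE hn a) (p a)

/-- The matrix consisting of the upper `n` rows of `D`. -/
def upperRows {ι : Type*} {N n : ℕ} (hn : n ≤ N) (D : Matrix (Fin N) ι ℤ) : Matrix (Fin n) ι ℤ :=
  D.submatrix (Fin.castLE hn) id

/-- The position (counted from `0`) of `j` in the finite linearly ordered index set. -/
def position {ι : Type*} [Fintype ι] [LinearOrder ι] (j : ι) : ℕ :=
  (Finset.univ.filter fun i => i < j).card

/-- `D` is in Smith normal form: it vanishes off the main diagonal, and the diagonal entries are
non-negative, each dividing the next one. (Only the entries `d a` with `a` less than both sizes of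
the matrix occur in `D`; the later ones may be taken to be `0`.) -/
def IsSmithNormalForm {ι : Type*} [Fintype ι] [LinearOrder ι] {n : ℕ}
    (D : Matrix (Fin n) ι ℤ) : Prop :=
  ∃ d : ℕ → ℤ, (∀ a j, D a j = if position j = a.val then d a.val else 0) ∧
    ∀ a, 0 ≤ d a ∧ d a ∣ d (a + 1)

/-- An integral matrix, seen as a rational one. -/
def ratMatrix {ι κ : Type*} (A : Matrix ι κ ℤ) : Matrix ι κ ℚ := A.map fun a => (a : ℚ)

/-- `D = U P V` is a Smith normal form of `P` with unimodular `U`, `V`, and `σ` is a rational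
section of `D`. -/
structure IsSmithData {ι : Type*} [Fintype ι] [LinearOrder ι] {n : ℕ} (P : Matrix (Fin n) ι ℤ)
    (U : Matrix (Fin n) (Fin n) ℤ) (V : Matrix ι ι ℤ) (D : Matrix (Fin n) ι ℤ)
    (σ : Matrix ι (Fin n) ℚ) : Prop where
  unimodular_left : IsUnit U.det
  unimodular_right : IsUnit V.det
  factor : D = U * P * V
  smith : IsSmithNormalForm D
  section_eq : ratMatrix D * σ = 1

/-- The Laurent polynomial `a_0 + a_1 T^{B_{1*}} + … + a_m T^{B_{m*}}`, where `a_0, …, a_m` are the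
coefficients of `g` at the exponents `ν_0, …, ν_m`. -/
def pushTerms {K ι : Type*} [Field K] {n : ℕ} (g : Laurent K ι) (ν : List (ι → ℤ))
    (B : Matrix (Fin (ν.length - 1)) (Fin n) ℤ) : Laurent K (Fin n) :=
  ∑ j : Fin ν.length, AddMonoidAlgebra.single
    (if hj : j.val = 0 then 0 else B ⟨j.val - 1, by omega⟩) (g.coeff (ν.get j))

/-! ### Faces of the orthant and orbits -/

/-- The orthant `γ = ℚ_{≥ 0}^r`. -/
abbrev orthant (r : ℕ) : PointedCone ℚ (Fin r → ℚ) := PointedCone.positive ℚ (Fin r → ℚ)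

/-- The indices `i` with `e_i ∈ γ₀`. -/
def faceIndex {r : ℕ} (γ₀ : PointedCone ℚ (Fin r → ℚ)) : Finset (Fin r) :=
  open scoped Classical in Finset.univ.filter fun i => (Pi.single i 1 : Fin r → ℚ) ∈ γ₀

/-- The orbit `T^r_{γ₀} = {t_{γ₀}; t ∈ T^r}` in `K^r`, where `t_{γ₀}` arises from `t` by replacing
the coordinates `t_i` with `e_i ∉ γ₀` by zero. -/
def orbit (K : Type*) [Field K] {r : ℕ} (γ₀ : PointedCone ℚ (Fin r → ℚ)) : Set (Fin r → K) :=
  {x | ∃ t : Torus K (Fin r), ∀ i, x i = if i ∈ faceIndex γ₀ then (t i : K) else 0}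

/-- `γ₀` is an `𝔞`-face: `V(T^r_{γ₀}; 𝔞) ≠ ∅`. -/
def IsAFace {K : Type*} [Field K] {r : ℕ} (𝔞 : Ideal (MvPolynomial (Fin r) K))
    (γ₀ : PointedCone ℚ (Fin r → ℚ)) : Prop :=
  ∃ x ∈ orbit K γ₀, ∀ f ∈ 𝔞, MvPolynomial.eval x f = 0

/-- The polynomial ring `K[T_{γ₀}]` in the variables `T_i` with `e_i ∈ γ₀`. -/
abbrev FacePoly (K : Type*) [Field K] {r : ℕ} (γ₀ : PointedCone ℚ (Fin r → ℚ)) : Type _ :=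
  MvPolynomial (faceIndex γ₀) K

/-- The orbit `T^r_{γ₀}` as a torus, with the coordinates `t_i`, `e_i ∈ γ₀`; the other coordinates
of the points of the orbit are zero. -/
abbrev FaceTorus (K : Type*) [Field K] {r : ℕ} (γ₀ : PointedCone ℚ (Fin r → ℚ)) : Type _ :=
  Torus K (faceIndex γ₀)

/-- `f_{γ₀} = f(T_{γ₀})`: each `T_i` with `e_i ∉ γ₀` is replaced by zero. -/
def faceReduce {K : Type*} [Field K] {r : ℕ} (γ₀ : PointedCone ℚ (Fin r → ℚ)) :
    MvPolynomial (Fin r) K →ₐ[K] FacePoly K γ₀ :=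
  MvPolynomial.aeval fun i => if hi : i ∈ faceIndex γ₀ then MvPolynomial.X ⟨i, hi⟩ else 0

/-- The ideal `𝔞_{γ₀}` generated by the `f_{γ₀}`, `f ∈ 𝔞`. -/
def faceIdeal {K : Type*} [Field K] {r : ℕ} (𝔞 : Ideal (MvPolynomial (Fin r) K))
    (γ₀ : PointedCone ℚ (Fin r → ℚ)) : Ideal (FacePoly K γ₀) :=
  Ideal.span (faceReduce γ₀ '' 𝔞)

/-- The ideal generated by `𝔞_{γ₀}` in the ring `𝒪(T^r_{γ₀})`. -/
def faceLaurentIdeal {K : Type*} [Field K] {r : ℕ} (𝔞 : Ideal (MvPolynomial (Fin r) K))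
    (γ₀ : PointedCone ℚ (Fin r → ℚ)) : Ideal (Laurent K (faceIndex γ₀)) :=
  (faceIdeal 𝔞 γ₀).map toLaurent

end GITFan

end

/-! Restriction to the orbit identifies `V(T^r_{γ₀}; 𝔞)` with `V`, so `γ₀` is an `𝔞`-face exactly
when `π(V)` is non-empty (`isAFace_iff_nonempty`). It remains to find equations for `π(V)`.

A matrix of full row rank gives a surjective `π`, because the units of an algebraically closed field
form a divisible, hence injective, abelian group (`torusHom_surjective`). If `h_i` is a push-forward
of the generator `g_i`, then `h_i(π(t)) = 0` if and only if `g_i(t) = 0`. So `V` is the full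
preimage of `V(h)`, and `π(V) = V(h)` (`image_torusZeros_eq_torusZerosPoly`). The Nullstellensatz
turns non-emptiness into the radical criterion.

For arbitrary elements of `𝔠`, independence of characters splits `f` into weight components for `ker
π`, each of which vanishes on the invariant set `V`. By the Nullstellensatz a power of each
component lies in `𝔠`, and this power has a push-forward (`image_torusZeros_eq_pushIdeal`). The same
independence shows that `H(γ₀)` is cut out by characters; a basis of their exponent lattice provides
`P` (`exists_describesQuotient`).

In the algorithm, `g` is semi-invariant under `t` if and only if `t^{ν_j - ν_0} = 1` for all `j`, so
the common semi-invariance group is `ker` of `P_G`. This depends only on the row lattice, which the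
Hermite form preserves. Hence `P_{g_i} = B_i P` over the integers, and multiplying by the section
`V' σ U'` of `P` recovers `B_i`. -/

noncomputable section

namespace GITFan

open Matrix

/-! ### Unimodular row and column operations -/

/-- The block matrix with first row `(1, w)`, first column `(1, 0)` and lower right block `U`. -/
def bordered {n : ℕ} (w : Fin n → ℤ) (U : Matrix (Fin n) (Fin n) ℤ) :
    Matrix (Fin (n + 1)) (Fin (n + 1)) ℤ :=
  Matrix.of (Fin.cons (Fin.cons 1 w) fun i => Fin.cons 0 (U i))

theorem bordered_zero_zero {n : ℕ} (w : Fin n → ℤ) (U : Matrix (Fin n) (Fin n) ℤ) :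
    bordered w U 0 0 = 1 := rfl

theorem bordered_zero_succ {n : ℕ} (w : Fin n → ℤ) (U : Matrix (Fin n) (Fin n) ℤ) (j : Fin n) :
    bordered w U 0 j.succ = w j := rfl

theorem bordered_succ_zero {n : ℕ} (w : Fin n → ℤ) (U : Matrix (Fin n) (Fin n) ℤ) (i : Fin n) :
    bordered w U i.succ 0 = 0 := rfl

theorem bordered_succ_succ {n : ℕ} (w : Fin n → ℤ) (U : Matrix (Fin n) (Fin n) ℤ)
    (i j : Fin n) : bordered w U i.succ j.succ = U i j := rfl

theorem det_bordered {n : ℕ} (w : Fin n → ℤ) (U : Matrix (Fin n) (Fin n) ℤ) :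
    (bordered w U).det = U.det := by
  rw [det_succ_column_zero, Fin.sum_univ_succ]
  simp only [bordered_succ_zero, bordered_zero_zero]
  simp only [Fin.val_zero, pow_zero, mul_one, one_mul, mul_zero, zero_mul, Finset.sum_const_zero,
    add_zero]
  congr 1

theorem bordered_mul_zero {n c : ℕ} (w : Fin n → ℤ) (U : Matrix (Fin n) (Fin n) ℤ)
    (B : Matrix (Fin (n + 1)) (Fin c) ℤ) (j : Fin c) :
    (bordered w U * B) 0 j = B 0 j + ∑ i, w i * B i.succ j := by
  simp [Matrix.mul_apply, Fin.sum_univ_succ, bordered_zero_zero, bordered_zero_succ]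

theorem bordered_mul_succ {n c : ℕ} (w : Fin n → ℤ) (U : Matrix (Fin n) (Fin n) ℤ)
    (B : Matrix (Fin (n + 1)) (Fin c) ℤ) (i : Fin n) (j : Fin c) :
    (bordered w U * B) i.succ j = ∑ k, U i k * B k.succ j := by
  simp [Matrix.mul_apply, Fin.sum_univ_succ, bordered_succ_zero, bordered_succ_succ]

theorem isUnit_det_mul {ι : Type*} [Fintype ι] [DecidableEq ι] {U V : Matrix ι ι ℤ}
    (hU : IsUnit U.det) (hV : IsUnit V.det) : IsUnit (U * V).det := by
  rw [det_mul]; exact hU.mul hV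

theorem isUnit_det_neg {ι : Type*} [Fintype ι] [DecidableEq ι] {U : Matrix ι ι ℤ}
    (hU : IsUnit U.det) : IsUnit (-U).det := by
  rw [det_neg]; exact ((isUnit_one.neg).pow _).mul hU

/-- Rows can be interchanged by a unimodular matrix. -/
theorem exists_unimodular_swap {ι κ : Type*} [Fintype ι] [DecidableEq ι] (i k : ι) :
    ∃ U : Matrix ι ι ℤ, IsUnit U.det ∧ ∀ (A : Matrix ι κ ℤ) (j : κ), (U * A) i j = A k j := by
  refine ⟨(Equiv.swap i k).permMatrix ℤ, ?_, fun A j => ?_⟩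
  · rw [det_permutation]
    exact Units.isUnit _
  · rw [Equiv.Perm.permMatrix, PEquiv.toMatrix_toPEquiv_mul]
    simp

theorem isUnit_det_transvection {ι : Type*} [Fintype ι] [DecidableEq ι] {i k : ι} (h : i ≠ k)
    (c : ℤ) : IsUnit (transvection i k c).det := by
  rw [det_transvection_of_ne i k h]; exact isUnit_one

theorem dvd_of_dvd_unimodular_mul {ι κ : Type*} [Fintype ι] [DecidableEq ι] {U : Matrix ι ι ℤ}
    (hU : IsUnit U.det) (A : Matrix ι κ ℤ) (j : κ) {d : ℤ} (h : ∀ i, d ∣ (U * A) i j) (i : ι) :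
    d ∣ A i j := by
  rw [← Matrix.nonsing_inv_mul_cancel_left U A hU, Matrix.mul_apply]
  exact Finset.dvd_sum fun k _ => (h k).mul_left _

theorem mul_bordered_zero {N c : ℕ} (B : Matrix (Fin N) (Fin (c + 1)) ℤ) (w : Fin c → ℤ)
    (U : Matrix (Fin c) (Fin c) ℤ) (i : Fin N) : (B * bordered w U) i 0 = B i 0 := by
  simp [Matrix.mul_apply, Fin.sum_univ_succ, bordered_succ_zero, bordered_zero_zero]

theorem mul_bordered_succ {N c : ℕ} (B : Matrix (Fin N) (Fin (c + 1)) ℤ) (w : Fin c → ℤ)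
    (U : Matrix (Fin c) (Fin c) ℤ) (i : Fin N) (j : Fin c) :
    (B * bordered w U) i j.succ = B i 0 * w j + ∑ k, B i k.succ * U k j := by
  simp [Matrix.mul_apply, Fin.sum_univ_succ, bordered_succ_succ, bordered_zero_succ]

/-- A column of an integral matrix can be cleared below its first entry. -/
theorem exists_unimodular_clear_column {N : ℕ} {κ : Type*} (A : Matrix (Fin (N + 1)) κ ℤ) (j : κ) :
    ∃ U : Matrix (Fin (N + 1)) (Fin (N + 1)) ℤ, IsUnit U.det ∧ 0 ≤ (U * A) 0 j ∧
      ∀ i : Fin N, (U * A) i.succ j = 0 := by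
  classical
  by_cases h0 : ∀ i, A i j = 0
  · exact ⟨1, by simp, by simp [h0], by simp [h0]⟩
  push Not at h0
  -- A non-zero entry of least absolute value in column `j`, over all unimodular multiples of `A`,
  -- replaces the Euclidean algorithm: a non-zero remainder on division by it would be smaller.
  have hex : ∃ k : ℕ, ∃ U : Matrix (Fin (N + 1)) (Fin (N + 1)) ℤ, IsUnit U.det ∧
      ∃ i, (U * A) i j ≠ 0 ∧ ((U * A) i j).natAbs = k := by
    obtain ⟨i, hi⟩ := h0
    exact ⟨_, 1, by simp, i, by simpa using hi, rfl⟩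
  obtain ⟨U₀, hU₀, i₀, hne₀, hk₀⟩ := Nat.find_spec hex
  have hmin : ∀ U : Matrix (Fin (N + 1)) (Fin (N + 1)) ℤ, IsUnit U.det → ∀ i, (U * A) i j ≠ 0 →
      Nat.find hex ≤ ((U * A) i j).natAbs := fun U hU i hi =>
    Nat.find_min' hex ⟨U, hU, i, hi, rfl⟩
  obtain ⟨S, hS, hSA⟩ := exists_unimodular_swap (κ := κ) 0 i₀
  obtain ⟨U₁, hU₁, hpos, hk₁⟩ : ∃ U : Matrix (Fin (N + 1)) (Fin (N + 1)) ℤ, IsUnit U.det ∧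
      0 < (U * A) 0 j ∧ ((U * A) 0 j).natAbs = Nat.find hex := by
    have h1 : ((S * U₀) * A) 0 j = (U₀ * A) i₀ j := by rw [Matrix.mul_assoc, hSA]
    rcases lt_or_gt_of_ne hne₀ with h | h
    · refine ⟨-(S * U₀), isUnit_det_neg (isUnit_det_mul hS hU₀), ?_, ?_⟩
      · rw [Matrix.neg_mul, Matrix.neg_apply, h1]; omega
      · rw [Matrix.neg_mul, Matrix.neg_apply, h1, Int.natAbs_neg, hk₀]
    · exact ⟨S * U₀, isUnit_det_mul hS hU₀, by rw [h1]; exact h, by rw [h1, hk₀]⟩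
  set B := U₁ * A with hB
  have hdvd : ∀ i : Fin N, B 0 j ∣ B i.succ j := by
    intro i
    have hne : i.succ ≠ 0 := Fin.succ_ne_zero i
    by_contra hnd
    have hval : ((transvection i.succ 0 (-(B i.succ j / B 0 j)) * U₁) * A) i.succ j =
        B i.succ j % B 0 j := by
      rw [Matrix.mul_assoc, transvection_mul_apply_same, ← hB, Int.emod_def]; ring
    have hr : B i.succ j % B 0 j ≠ 0 := fun h => hnd (Int.dvd_of_emod_eq_zero h)
    have := hmin _ (isUnit_det_mul (isUnit_det_transvection hne _) hU₁) i.succ (by rwa [hval])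
    rw [hval, ← hk₁] at this
    have h1 := Int.emod_lt_of_pos (B i.succ j) hpos
    have h2 := Int.emod_nonneg (B i.succ j) hpos.ne'
    omega
  -- Subtracts from each lower row its quotient times row `0`; the matrix is lower triangular with
  -- unit diagonal.
  refine ⟨(1 - vecMulVec (fun i => if i = 0 then 0 else B i j / B 0 j) (Pi.single 0 1)) * U₁,
    isUnit_det_mul ?_ hU₁, ?_, ?_⟩
  · rw [det_of_isLowerTriangular]
    · refine IsUnit.of_mul_eq_one 1 ?_
      rw [mul_one]
      refine Finset.prod_eq_one fun i _ => ?_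
      by_cases hi : i = 0 <;> simp [vecMulVec_apply, hi]
    · intro i k hik
      have hik : i < k := hik
      have : k ≠ 0 := ((Fin.zero_le i).trans_lt hik).ne'
      simp [vecMulVec_apply, this, hik.ne]
  · rw [Matrix.mul_assoc, ← hB, Matrix.sub_mul, Matrix.one_mul]
    simp [Matrix.mul_apply, vecMulVec_apply, hpos.le]
  · intro i
    rw [Matrix.mul_assoc, ← hB, Matrix.sub_mul, Matrix.one_mul]
    simp [Matrix.mul_apply, vecMulVec_apply, Pi.single_apply, Int.ediv_mul_cancel (hdvd i)]

/-! ### The Hermite normal form -/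

/-- Reduction of a vector modulo the rows of a matrix in echelon form. -/
theorem exists_reduction {ι : Type*} [LinearOrder ι] {n : ℕ} (R : Fin n → ι → ℤ) (p : Fin n → ι)
    (hp : StrictMono p) (hpos : ∀ a, 0 < R a (p a)) (hz : ∀ a j, j < p a → R a j = 0)
    (w : ι → ℤ) :
    ∃ c : Fin n → ℤ, ∀ a, 0 ≤ w (p a) - ∑ b, c b * R b (p a) ∧
      w (p a) - ∑ b, c b * R b (p a) < R a (p a) := by
  induction n generalizing w with
  | zero => exact ⟨0, fun a => a.elim0⟩
  | succ n ih =>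
    obtain ⟨c, hc⟩ := ih (fun a => R a.succ) (fun a => p a.succ)
      (fun a b h => hp (Fin.succ_lt_succ_iff.2 h)) (fun a => hpos _) (fun a => hz _)
      -- Row `0` is used before the others: the later rows vanish in column `p 0`, so they leave the
      -- entry reduced there untouched.
      (fun j => w j - w (p 0) / R 0 (p 0) * R 0 j)
    refine ⟨Fin.cons (w (p 0) / R 0 (p 0)) c, fun a => ?_⟩
    rw [Fin.sum_univ_succ]
    simp only [Fin.cons_zero, Fin.cons_succ]
    induction a using Fin.cases with
    | zero =>
      have : ∑ b : Fin n, c b * R b.succ (p 0) = 0 :=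
        Finset.sum_eq_zero fun b _ => by rw [hz _ _ (hp (Fin.succ_pos b)), mul_zero]
      rw [this, add_zero, mul_comm, ← Int.emod_def]
      exact ⟨Int.emod_nonneg _ (hpos 0).ne', Int.emod_lt_of_pos _ (hpos 0)⟩
    | succ a =>
      have := hc a
      rwa [sub_sub] at this

/-- Induction on the number of columns. A zero first column is dropped; otherwise it is cleared
below a positive pivot, the remaining block is brought to normal form, and the first row is reduced
modulo the rows obtained. -/
theorem exists_hermite_fin (c : ℕ) : ∀ (N : ℕ) (A : Matrix (Fin N) (Fin c) ℤ),
    ∃ (n : ℕ) (hn : n ≤ N) (U : Matrix (Fin N) (Fin N) ℤ),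
      IsUnit U.det ∧ IsHermiteNormalForm hn (U * A) := by
  induction c with
  | zero =>
    exact fun N A => ⟨0, Nat.zero_le _, 1, by simp, fun _ _ j => j.elim0,
      fun a => a.elim0, fun a => a.elim0, fun a => a.elim0⟩
  | succ c ih =>
    intro N A
    obtain _ | M := N
    · exact ⟨0, le_rfl, 1, by simp, fun a => a.elim0, fun a => a.elim0, fun a => a.elim0,
        fun a => a.elim0⟩
    obtain ⟨U₁, hU₁, hnn, hcol⟩ := exists_unimodular_clear_column A 0
    set B := U₁ * A with hB
    rcases hnn.eq_or_lt with h0 | hpos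
    · have hcol' : ∀ i, B i 0 = 0 := fun i => by
        induction i using Fin.cases with
        | zero => exact h0.symm
        | succ i => exact hcol i
      obtain ⟨n, hn, U, hU, hlow, p, hp, hech⟩ := ih _ (B.submatrix id Fin.succ)
      have hz : ∀ i, (U * U₁ * A) i 0 = 0 := fun i => by
        rw [Matrix.mul_assoc, ← hB, Matrix.mul_apply]
        exact Finset.sum_eq_zero fun k _ => by rw [hcol', mul_zero]
      have hs : ∀ i j, (U * U₁ * A) i (Fin.succ j) = (U * B.submatrix id Fin.succ) i j :=
        fun i j => by rw [Matrix.mul_assoc, ← hB]; rfl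
      refine ⟨n, hn, U * U₁, isUnit_det_mul hU hU₁, fun a ha j => ?_, fun a => (p a).succ,
        fun a b h => Fin.succ_lt_succ_iff.2 (hp h), fun a => ⟨?_, fun j hj => ?_, fun b hb => ?_⟩⟩
      · induction j using Fin.cases with
        | zero => exact hz a
        | succ j => rw [hs]; exact hlow a ha j
      · rw [hs]; exact (hech a).1
      · induction j using Fin.cases with
        | zero => exact hz _
        | succ j => rw [hs]; exact (hech a).2.1 j (Fin.succ_lt_succ_iff.1 hj)
      · rw [hs, hs]; exact (hech a).2.2 b hb
    · obtain ⟨n, hn, U, hU, hlow, p, hp, hech⟩ := ih _ (B.submatrix Fin.succ Fin.succ)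
      set D := U * B.submatrix Fin.succ Fin.succ with hD
      obtain ⟨q, hq⟩ := exists_reduction (fun a => D (Fin.castLE hn a)) p hp
        (fun a => (hech a).1) (fun a => (hech a).2.1) (fun j => B 0 j.succ)
      have hs : ∀ (w : Fin M → ℤ) i j, (bordered w U * U₁ * A) (Fin.succ i) (Fin.succ j) = D i j :=
        fun w i j => by
          rw [Matrix.mul_assoc, ← hB, bordered_mul_succ, hD, Matrix.mul_apply]; rfl
      have hz : ∀ (w : Fin M → ℤ) i, (bordered w U * U₁ * A) (Fin.succ i) 0 = 0 := fun w i => by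
        rw [Matrix.mul_assoc, ← hB, bordered_mul_succ]
        exact Finset.sum_eq_zero fun k _ => by rw [hcol, mul_zero]
      -- With this border the first row becomes row `0` of `B` minus the combination of echelon rows
      -- supplied by `exists_reduction`.
      set w : Fin M → ℤ := fun k => -∑ a, q a * U (Fin.castLE hn a) k with hw
      have h00 : (bordered w U * U₁ * A) 0 0 = B 0 0 := by
        rw [Matrix.mul_assoc, ← hB, bordered_mul_zero]
        simp [hcol]
      have h0s : ∀ j, (bordered w U * U₁ * A) 0 (Fin.succ j) =
          B 0 j.succ - ∑ a, q a * D (Fin.castLE hn a) j := fun j => by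
        rw [Matrix.mul_assoc, ← hB, bordered_mul_zero, sub_eq_add_neg]
        congr 1
        simp only [hw, hD, Matrix.mul_apply, neg_mul, Finset.sum_neg_distrib, Finset.sum_mul,
          Finset.mul_sum, Matrix.submatrix_apply]
        rw [Finset.sum_comm]
        simp only [mul_assoc]
      have hcast : ∀ a : Fin n, Fin.castLE (Nat.succ_le_succ hn) a.succ =
          (Fin.castLE hn a).succ := fun a => rfl
      have hcast0 : Fin.castLE (Nat.succ_le_succ hn) 0 = 0 := rfl
      refine ⟨n + 1, Nat.succ_le_succ hn, bordered w U * U₁,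
        isUnit_det_mul (by rwa [det_bordered]) hU₁, fun a ha j => ?_,
        Fin.cons 0 fun a => (p a).succ, ?_, fun a => ?_⟩
      · induction a using Fin.cases with
        | zero => simp at ha
        | succ a =>
          induction j using Fin.cases with
          | zero => exact hz w a
          | succ j => rw [hs]; exact hlow a (by simpa using ha) j
      · intro a b hab
        induction b using Fin.cases with
        | zero => exact absurd hab (Fin.not_lt_zero a)
        | succ b =>
          induction a using Fin.cases with
          | zero => exact Fin.succ_pos _
          | succ a => exact Fin.succ_lt_succ_iff.2 (hp (Fin.succ_lt_succ_iff.1 hab))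
      · induction a using Fin.cases with
        | zero =>
          rw [Fin.cons_zero, hcast0]
          exact ⟨h00 ▸ hpos, fun j hj => absurd hj (Fin.not_lt_zero j),
            fun b hb => absurd hb (Fin.not_lt_zero b)⟩
        | succ a =>
          rw [Fin.cons_succ, hcast]
          refine ⟨by rw [hs]; exact (hech a).1, fun j hj => ?_, fun b hb => ?_⟩
          · induction j using Fin.cases with
            | zero => exact hz w _
            | succ j => rw [hs]; exact (hech a).2.1 j (Fin.succ_lt_succ_iff.1 hj)
          · induction b using Fin.cases with
            | zero => rw [hcast0, h0s, hs]; exact hq a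
            | succ b =>
              rw [hcast, hs, hs]; exact (hech a).2.2 b (Fin.succ_lt_succ_iff.1 hb)

/-- Every integral matrix has a Hermite normal form. -/
theorem exists_isHermiteNormalForm {ι : Type*} [Fintype ι] [LinearOrder ι] {N : ℕ}
    (A : Matrix (Fin N) ι ℤ) :
    ∃ (n : ℕ) (hn : n ≤ N) (U : Matrix (Fin N) (Fin N) ℤ) (D : Matrix (Fin N) ι ℤ),
      IsUnit U.det ∧ D = U * A ∧ IsHermiteNormalForm hn D := by
  let e : Fin (Fintype.card ι) ≃o ι := Fintype.orderIsoFinOfCardEq ι rfl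
  obtain ⟨n, hn, U, hU, hlow, p, hp, hech⟩ := exists_hermite_fin _ N (A.submatrix id e)
  have hs : ∀ i j, (U * A) i j = (U * A.submatrix id e) i (e.symm j) := fun i j => by
    simp [Matrix.mul_apply]
  refine ⟨n, hn, U, U * A, hU, rfl, fun a ha j => by rw [hs]; exact hlow a ha _,
    fun a => e (p a), fun a b h => e.lt_iff_lt.2 (hp h), fun a => ⟨?_, fun j hj => ?_,
    fun b hb => ?_⟩⟩
  · rw [hs, e.symm_apply_apply]; exact (hech a).1
  · rw [hs]; exact (hech a).2.1 _ (by rwa [e.symm_apply_lt])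
  · rw [hs, hs, e.symm_apply_apply]; exact (hech a).2.2 b hb

/-! ### The Smith normal form -/

/-- A non-zero integral matrix can be brought into a form where the first entry divides all others
and is the only non-zero one in its row and column. -/
theorem exists_unimodular_pivot {N c : ℕ} (A : Matrix (Fin (N + 1)) (Fin (c + 1)) ℤ) (hA : A ≠ 0) :
    ∃ (U : Matrix (Fin (N + 1)) (Fin (N + 1)) ℤ) (V : Matrix (Fin (c + 1)) (Fin (c + 1)) ℤ),
      IsUnit U.det ∧ IsUnit V.det ∧ 0 < (U * A * V) 0 0 ∧
      (∀ i : Fin N, (U * A * V) i.succ 0 = 0) ∧ (∀ j : Fin c, (U * A * V) 0 j.succ = 0) ∧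
      ∀ i j, (U * A * V) 0 0 ∣ (U * A * V) i j := by
  classical
  -- Here the minimum is taken over all non-zero entries of all matrices `U * A * V`.
  have hex : ∃ k : ℕ, ∃ (U : Matrix (Fin (N + 1)) (Fin (N + 1)) ℤ)
      (V : Matrix (Fin (c + 1)) (Fin (c + 1)) ℤ), IsUnit U.det ∧ IsUnit V.det ∧
      ∃ i j, (U * A * V) i j ≠ 0 ∧ ((U * A * V) i j).natAbs = k := by
    obtain ⟨i, j, h⟩ : ∃ i j, A i j ≠ 0 := by
      by_contra! h
      exact hA (Matrix.ext h)
    exact ⟨_, 1, 1, by simp, by simp, i, j, by simpa using h, rfl⟩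
  obtain ⟨U₀, V₀, hU₀, hV₀, i₀, j₀, hne₀, hk₀⟩ := Nat.find_spec hex
  have hmin : ∀ (U : Matrix (Fin (N + 1)) (Fin (N + 1)) ℤ)
      (V : Matrix (Fin (c + 1)) (Fin (c + 1)) ℤ), IsUnit U.det → IsUnit V.det → ∀ i j,
      (U * A * V) i j ≠ 0 → Nat.find hex ≤ ((U * A * V) i j).natAbs := fun U V hU hV i j h =>
    Nat.find_min' hex ⟨U, V, hU, hV, i, j, h, rfl⟩
  -- an entry of minimal absolute value divides the entries in its column and row
  have hcol : ∀ (U : Matrix (Fin (N + 1)) (Fin (N + 1)) ℤ)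
      (V : Matrix (Fin (c + 1)) (Fin (c + 1)) ℤ), IsUnit U.det → IsUnit V.det → ∀ i k j,
      (U * A * V) i j ≠ 0 → ((U * A * V) i j).natAbs = Nat.find hex →
      (U * A * V) i j ∣ (U * A * V) k j := by
    intro U V hU hV i k j hne hk
    rcases eq_or_ne k i with rfl | hki
    · exact dvd_rfl
    by_contra hnd
    set B := U * A * V with hB
    have hval : ((transvection k i (-(B k j / B i j)) * U) * A * V) k j = B k j % B i j := by
      rw [Matrix.mul_assoc, Matrix.mul_assoc, ← Matrix.mul_assoc U, transvection_mul_apply_same,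
        ← hB, Int.emod_def]; ring
    have hr : B k j % B i j ≠ 0 := fun h => hnd (Int.dvd_of_emod_eq_zero h)
    have := hmin _ V (isUnit_det_mul (isUnit_det_transvection hki _) hU) hV k j (by rwa [hval])
    rw [hval, ← hk] at this
    have h1 := Int.emod_lt_abs (B k j) hne
    rw [Int.abs_eq_natAbs] at h1
    have h2 := Int.emod_nonneg (B k j) hne
    omega
  have hrow : ∀ (U : Matrix (Fin (N + 1)) (Fin (N + 1)) ℤ)
      (V : Matrix (Fin (c + 1)) (Fin (c + 1)) ℤ), IsUnit U.det → IsUnit V.det → ∀ i j k,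
      (U * A * V) i j ≠ 0 → ((U * A * V) i j).natAbs = Nat.find hex →
      (U * A * V) i j ∣ (U * A * V) i k := by
    intro U V hU hV i j k hne hk
    rcases eq_or_ne k j with rfl | hkj
    · exact dvd_rfl
    by_contra hnd
    set B := U * A * V with hB
    have hval : (U * A * (V * transvection j k (-(B i k / B i j)))) i k = B i k % B i j := by
      rw [← Matrix.mul_assoc, mul_transvection_apply_same, ← hB, Int.emod_def]; ring
    have hr : B i k % B i j ≠ 0 := fun h => hnd (Int.dvd_of_emod_eq_zero h)
    have := hmin U _ hU (isUnit_det_mul hV (isUnit_det_transvection hkj.symm _)) i k (by rwa [hval])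
    rw [hval, ← hk] at this
    have h1 := Int.emod_lt_abs (B i k) hne
    rw [Int.abs_eq_natAbs] at h1
    have h2 := Int.emod_nonneg (B i k) hne
    omega
  -- move the minimal entry to the first column, clear that column and then the first row
  obtain ⟨T, hT, hTA⟩ := exists_unimodular_swap (κ := Fin (N + 1)) 0 j₀
  have hV₁ : IsUnit (V₀ * Tᵀ).det := isUnit_det_mul hV₀ (by rwa [det_transpose])
  have hent₁ : ∀ i, (U₀ * A * (V₀ * Tᵀ)) i 0 = (U₀ * A * V₀) i j₀ := fun i => by
    rw [← Matrix.mul_assoc, ← transpose_apply (U₀ * A * V₀ * Tᵀ), transpose_mul,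
      transpose_transpose, hTA, transpose_apply]
  obtain ⟨S, hS, hnn, hclear⟩ := exists_unimodular_clear_column (U₀ * A * (V₀ * Tᵀ)) 0
  set U₁ := S * U₀ with hU₁
  set V₁ := V₀ * Tᵀ with hV₁'
  have hUnit : IsUnit U₁.det := isUnit_det_mul hS hU₀
  have hSU : S * (U₀ * A * V₁) = U₁ * A * V₁ := by simp only [hU₁, Matrix.mul_assoc]
  rw [hSU] at hnn hclear
  set b := (U₁ * A * V₁) 0 0 with hb
  -- The cleared column has only multiples of `b`; undoing the row operation, `b` divides the
  -- minimal entry and is therefore itself minimal.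
  have hbdvd : b ∣ (U₀ * A * V₀) i₀ j₀ := by
    rw [← hent₁]
    refine dvd_of_dvd_unimodular_mul hS _ _ (fun i => ?_) _
    rw [hSU]
    induction i using Fin.cases with
    | zero => exact dvd_rfl
    | succ i => rw [hclear]; exact dvd_zero _
  have hb0 : b ≠ 0 := by
    rintro h
    rw [h] at hbdvd
    exact hne₀ (zero_dvd_iff.1 hbdvd)
  have hbmin : b.natAbs = Nat.find hex :=
    le_antisymm (hk₀ ▸ Nat.le_of_dvd (Int.natAbs_pos.2 hne₀) (Int.natAbs_dvd_natAbs.2 hbdvd))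
      (hmin U₁ V₁ hUnit hV₁ 0 0 hb0)
  set w : Fin c → ℤ := fun j => -((U₁ * A * V₁) 0 j.succ / b) with hw
  have hV₂ : IsUnit (V₁ * bordered w 1).det := isUnit_det_mul hV₁ (by rw [det_bordered]; simp)
  have h0 : ∀ i, (U₁ * A * (V₁ * bordered w 1)) i 0 = (U₁ * A * V₁) i 0 := fun i => by
    rw [← Matrix.mul_assoc, mul_bordered_zero]
  have hr : ∀ j : Fin c, (U₁ * A * (V₁ * bordered w 1)) 0 j.succ = 0 := fun j => by
    rw [← Matrix.mul_assoc, mul_bordered_succ, ← hb, hw]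
    simp only [Matrix.one_apply, mul_ite, mul_one, mul_zero, Finset.sum_ite_eq',
      Finset.mem_univ, if_true]
    rw [mul_neg, Int.mul_ediv_cancel' (hrow U₁ V₁ hUnit hV₁ 0 0 _ hb0 hbmin), neg_add_cancel]
  refine ⟨U₁, V₁ * bordered w 1, hUnit, hV₂, ?_, fun i => by rw [h0, hclear], hr, ?_⟩
  · rw [h0]; exact lt_of_le_of_ne hnn hb0.symm
  intro i j
  set W : Matrix (Fin (c + 1)) (Fin (c + 1)) ℤ := V₁ * bordered w 1
  induction i using Fin.cases with
  | zero =>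
    induction j using Fin.cases with
    | zero => exact dvd_rfl
    | succ j => rw [hr]; exact dvd_zero _
  | succ i =>
    induction j using Fin.cases with
    | zero => rw [h0 i.succ, hclear]; exact dvd_zero _
    | succ j =>
      -- Adding row `i.succ` to row `0` keeps the pivot, since the added row starts with `0`, and
      -- puts the entry to be divided into the pivot row, where `hrow` applies.
      have hval : ∀ k, ((transvection 0 i.succ 1 * U₁) * A * W : Matrix _ _ ℤ) 0 k =
          (U₁ * A * W) 0 k + (U₁ * A * W) i.succ k := fun k => by
        rw [Matrix.mul_assoc, Matrix.mul_assoc, ← Matrix.mul_assoc U₁, transvection_mul_apply_same,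
          one_mul]
      have := hrow (transvection 0 i.succ 1 * U₁) W
        (isUnit_det_mul (isUnit_det_transvection (Fin.succ_ne_zero i).symm _) hUnit) hV₂ 0 0 j.succ
      rw [hval, hval, h0, h0, hclear, hr, add_zero, zero_add] at this
      rw [h0]
      exact this hb0 hbmin

/-- The last clause, on common divisors, strengthens the induction: the pivot divides the remaining
block, hence also the next diagonal entry. -/
theorem exists_smith_fin (n : ℕ) : ∀ (c : ℕ) (A : Matrix (Fin n) (Fin c) ℤ),
    ∃ (U : Matrix (Fin n) (Fin n) ℤ) (V : Matrix (Fin c) (Fin c) ℤ) (d : ℕ → ℤ),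
      IsUnit U.det ∧ IsUnit V.det ∧
      (∀ a j, (U * A * V) a j = if j.val = a.val then d a.val else 0) ∧
      (∀ a, 0 ≤ d a ∧ d a ∣ d (a + 1)) ∧ ∀ k, (∀ i j, k ∣ A i j) → ∀ a, k ∣ d a := by
  induction n with
  | zero => exact fun c A => ⟨1, 1, 0, by simp, by simp, fun a => a.elim0, by simp, by simp⟩
  | succ n ih =>
    intro c A
    by_cases hA : A = 0
    · exact ⟨1, 1, 0, by simp, by simp, by simp [hA], by simp, by simp⟩
    obtain _ | c := c
    · exact absurd (Subsingleton.elim A 0) hA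
    obtain ⟨U₁, V₁, hU₁, hV₁, hpos, hcol, hrow, hdvd⟩ := exists_unimodular_pivot A hA
    set B := U₁ * A * V₁ with hB
    obtain ⟨U, V, d, hU, hV, hd, hd', hk⟩ := ih c (B.submatrix Fin.succ Fin.succ)
    have hmul : bordered 0 U * U₁ * A * (V₁ * bordered 0 V) = bordered 0 U * B * bordered 0 V := by
      simp only [hB, Matrix.mul_assoc]
    refine ⟨bordered 0 U * U₁, V₁ * bordered 0 V, fun a => Nat.casesOn a (B 0 0) d,
      isUnit_det_mul (by rwa [det_bordered]) hU₁, isUnit_det_mul hV₁ (by rwa [det_bordered]),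
      fun a j => ?_, fun a => ?_, fun k hkA a => ?_⟩
    · rw [hmul]
      induction j using Fin.cases with
      | zero =>
        rw [mul_bordered_zero]
        induction a using Fin.cases with
        | zero => simp [bordered_mul_zero]
        | succ a => simp [bordered_mul_succ, hcol]
      | succ j =>
        rw [mul_bordered_succ]
        induction a using Fin.cases with
        | zero => simp [bordered_mul_zero, hrow]
        | succ a =>
          have := hd a j
          simp only [Matrix.mul_apply, Matrix.submatrix_apply] at this
          simpa [bordered_mul_succ] using this
    · cases a with
      | zero => exact ⟨hpos.le, hk _ (fun i j => hdvd _ _) 0⟩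
      | succ a => exact hd' a
    · have hkB : ∀ i j, k ∣ B i j := fun i j => by
        rw [hB, Matrix.mul_apply]
        refine Finset.dvd_sum fun l _ => Dvd.dvd.mul_right ?_ _
        rw [Matrix.mul_apply]
        exact Finset.dvd_sum fun m _ => (hkA _ _).mul_left _
      cases a with
      | zero => exact hkB 0 0
      | succ a => exact hk k (fun i j => hkB _ _) a

theorem position_orderIso {ι : Type*} [Fintype ι] [LinearOrder ι] {c : ℕ} (e : Fin c ≃o ι)
    (j : ι) : position j = (e.symm j).val := by
  rw [position, ← Fin.card_Iio (e.symm j), ← Finset.card_map e.toEmbedding]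
  congr 1
  ext i
  simp only [Finset.mem_filter, Finset.mem_univ, true_and, Finset.mem_map, Finset.mem_Iio]
  constructor
  · intro h
    exact ⟨e.symm i, e.symm.lt_iff_lt.2 h, e.apply_symm_apply i⟩
  · rintro ⟨k, hk, rfl⟩
    exact e.lt_symm_apply.1 hk

theorem position_injective {ι : Type*} [Fintype ι] [LinearOrder ι] :
    Function.Injective (position : ι → ℕ) := by
  let e : Fin (Fintype.card ι) ≃o ι := Fintype.orderIsoFinOfCardEq ι rfl
  intro i j h
  rw [position_orderIso e, position_orderIso e] at h
  exact e.symm.injective (Fin.val_injective h)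

/-- Every integral matrix has a Smith normal form. -/
theorem exists_isSmithNormalForm {ι : Type*} [Fintype ι] [LinearOrder ι] {n : ℕ}
    (P : Matrix (Fin n) ι ℤ) :
    ∃ (U : Matrix (Fin n) (Fin n) ℤ) (V : Matrix ι ι ℤ),
      IsUnit U.det ∧ IsUnit V.det ∧ IsSmithNormalForm (U * P * V) := by
  let e : Fin (Fintype.card ι) ≃o ι := Fintype.orderIsoFinOfCardEq ι rfl
  obtain ⟨U, V, d, hU, hV, hd, hd', -⟩ := exists_smith_fin n _ (P.submatrix id e)
  refine ⟨U, V.submatrix e.symm e.symm, hU, ?_, d, fun a j => ?_, hd'⟩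
  · exact (det_submatrix_equiv_self e.symm.toEquiv V).symm ▸ hV
  · rw [position_orderIso e, ← hd a (e.symm j)]
    simp only [Matrix.mul_apply, Matrix.submatrix_apply, id]
    rw [← e.toEquiv.sum_comp]
    simp

/-- Multiplication by unimodular matrices preserves full row rank. -/
theorem vecMul_injective_unimodular {ι : Type*} [Fintype ι] [DecidableEq ι] {n : ℕ}
    {P : Matrix (Fin n) ι ℤ} (hP : LinearIndependent ℤ P.row) {U : Matrix (Fin n) (Fin n) ℤ}
    {V : Matrix ι ι ℤ} (hU : IsUnit U.det) (hV : IsUnit V.det) {x : Fin n → ℤ}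
    (hx : x ᵥ* (U * P * V) = 0) : x = 0 := by
  rw [← vecMul_injective_iff] at hP
  have hU' := vecMul_injective_of_isUnit ((isUnit_iff_isUnit_det U).2 hU)
  have hV' := vecMul_injective_of_isUnit ((isUnit_iff_isUnit_det V).2 hV)
  rw [← vecMul_vecMul, ← vecMul_vecMul] at hx
  exact hU' ((hP ((hV' (hx.trans (zero_vecMul V).symm)).trans (zero_vecMul P).symm)).trans
    (zero_vecMul U).symm)

/-- A matrix of full row rank has a Smith normal form with a rational section. -/
theorem exists_isSmithData {ι : Type*} [Fintype ι] [LinearOrder ι] {n : ℕ}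
    (P : Matrix (Fin n) ι ℤ) (hP : LinearIndependent ℤ P.row) :
    ∃ U V D σ, IsSmithData P U V D σ := by
  obtain ⟨U, V, hU, hV, hD⟩ := exists_isSmithNormalForm P
  obtain ⟨d, hd, -⟩ := id hD
  -- If row `a` had no non-zero diagonal entry, `e_a` would annihilate `U * P * V`, against full row
  -- rank. The section then inverts the diagonal entries.
  have hne : ∀ a : Fin n, ∃ j : ι, position j = a.val ∧ d a.val ≠ 0 := by
    intro a
    by_contra! h
    have : (Pi.single a 1 : Fin n → ℤ) ᵥ* (U * P * V) = 0 := by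
      funext j
      rw [single_one_vecMul, row_apply, hd]
      split_ifs with hj
      · exact h j hj
      · rfl
    have := congrFun (vecMul_injective_unimodular hP hU hV this) a
    simp at this
  choose q hq hdne using hne
  refine ⟨U, V, U * P * V,
    Matrix.of fun j a => if position j = a.val then (d a.val : ℚ)⁻¹ else 0, hU, hV, rfl, hD, ?_⟩
  ext a b
  rw [Matrix.mul_apply, Finset.sum_eq_single (q a)]
  · rw [ratMatrix, Matrix.map_apply, hd, Matrix.of_apply, if_pos (hq a), hq a, Matrix.one_apply]
    by_cases hab : a = b
    · subst hab
      simp [hdne a]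
    · simp [hab, Fin.val_inj]
  · intro j _ hj
    rw [ratMatrix, Matrix.map_apply, hd, if_neg, Int.cast_zero, zero_mul]
    intro h
    exact hj (position_injective (h.trans (hq a).symm))
  · simp

theorem ratMatrix_mul {ι κ τ : Type*} [Fintype κ] (A : Matrix ι κ ℤ) (B : Matrix κ τ ℤ) :
    ratMatrix (A * B) = ratMatrix A * ratMatrix B :=
  Matrix.map_mul (f := Int.castRingHom ℚ)

/-- `V σ U` is a rational section of `P`. -/
theorem IsSmithData.section_of {ι : Type*} [Fintype ι] [LinearOrder ι] {n : ℕ}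
    {P : Matrix (Fin n) ι ℤ} {U : Matrix (Fin n) (Fin n) ℤ} {V : Matrix ι ι ℤ}
    {D : Matrix (Fin n) ι ℤ} {σ : Matrix ι (Fin n) ℚ} (h : IsSmithData P U V D σ) :
    ratMatrix P * ratMatrix V * σ * ratMatrix U = 1 := by
  have h1 : ratMatrix U * (ratMatrix P * ratMatrix V * σ) = 1 := by
    rw [← h.section_eq, h.factor, ratMatrix_mul, ratMatrix_mul]
    simp only [Matrix.mul_assoc]
  -- For square matrices a one-sided inverse is two-sided, so `U` may move to the right.
  exact mul_eq_one_comm.1 h1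

/-! ### Characters of a torus -/

section Characters

variable {K : Type*} [Field K] {ι κ : Type*} [Fintype ι] [Fintype κ]

theorem chi_zero (t : Torus K ι) : t.chi 0 = 1 := by simp [Torus.chi]

theorem chi_add (t : Torus K ι) (a b : ι → ℤ) : t.chi (a + b) = t.chi a * t.chi b := by
  simp [Torus.chi, _root_.zpow_add, Finset.prod_mul_distrib]

theorem chi_neg (t : Torus K ι) (a : ι → ℤ) : t.chi (-a) = (t.chi a)⁻¹ := by
  simp [Torus.chi]

theorem chi_sub (t : Torus K ι) (a b : ι → ℤ) : t.chi (a - b) = t.chi a / t.chi b := by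
  rw [sub_eq_add_neg, chi_add, chi_neg, div_eq_mul_inv]

theorem one_chi (a : ι → ℤ) : (1 : Torus K ι).chi a = 1 := by simp [Torus.chi]

theorem mul_chi (t u : Torus K ι) (a : ι → ℤ) : (t * u).chi a = t.chi a * u.chi a := by
  simp [Torus.chi, mul_zpow, Finset.prod_mul_distrib]

/-- The homomorphism `ν ↦ t^ν`. -/
def chiHom (t : Torus K ι) : (ι → ℤ) →+ Additive Kˣ where
  toFun ν := Additive.ofMul (t.chi ν)
  map_zero' := by rw [chi_zero]; rfl
  map_add' a b := by rw [chi_add]; rfl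

/-- The character `t ↦ t^ν` with values in the field. -/
def charHom (ν : ι → ℤ) : Torus K ι →* K where
  toFun t := (t.chi ν : K)
  map_one' := by rw [one_chi]; rfl
  map_mul' a b := by rw [mul_chi]; rfl

/-- Torus points are the same as homomorphisms from the exponent lattice to the units, so extending
homomorphisms constructs points. -/
theorem exists_chiHom_eq (φ : (ι → ℤ) →+ Additive Kˣ) : ∃ t : Torus K ι, chiHom t = φ := by
  classical
  refine ⟨fun i => (φ (Pi.single i 1)).toMul, AddMonoidHom.functions_ext' _ _ _ fun i => ?_⟩
  ext
  simp [chiHom, Torus.chi, Pi.single_apply]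

theorem chi_sum {τ : Type*} (t : Torus K ι) (s : Finset τ) (a : τ → ι → ℤ) :
    t.chi (∑ i ∈ s, a i) = ∏ i ∈ s, t.chi (a i) :=
  map_sum (chiHom t) a s

theorem chi_zsmul (t : Torus K ι) (k : ℤ) (a : ι → ℤ) : t.chi (k • a) = t.chi a ^ k :=
  map_zsmul (chiHom t) k a

theorem chi_torusHom (A : Matrix κ ι ℤ) (t : Torus K ι) (m : κ → ℤ) :
    (torusHom K A t).chi m = t.chi (m ᵥ* A) := by
  rw [vecMul_eq_sum, chi_sum]
  exact Finset.prod_congr rfl fun j _ => (chi_zsmul t (m j) (A j)).symm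

theorem mem_ker_torusHom (A : Matrix κ ι ℤ) (t : Torus K ι) :
    t ∈ (torusHom K A).ker ↔ ∀ m, t.chi (m ᵥ* A) = 1 := by
  classical
  rw [MonoidHom.mem_ker]
  constructor
  · intro h m
    rw [← chi_torusHom, h, one_chi]
  · intro h
    funext j
    have := h (Pi.single j 1)
    rw [single_one_vecMul] at this
    exact this

/-! ### Evaluation of Laurent polynomials -/

theorem eval_single (t : Torus K ι) (m : ι → ℤ) (a : K) :
    Laurent.eval t (AddMonoidAlgebra.single m a) = a * t.chi m := by
  simp [Laurent.eval, AddMonoidAlgebra.lift_single]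

theorem sum_single_coeff {α : Type*} (g : Laurent K α) :
    ∑ m ∈ g.coeff.support, AddMonoidAlgebra.single m (g.coeff m) = g :=
  AddMonoidAlgebra.sum_coeff_single g

theorem eval_eq_sum (t : Torus K ι) (g : Laurent K ι) :
    Laurent.eval t g = ∑ m ∈ g.coeff.support, g.coeff m * t.chi m := by
  conv_lhs => rw [← sum_single_coeff g]
  rw [map_sum]
  exact Finset.sum_congr rfl fun m _ => eval_single t m _

theorem pullback_single {α : Type*} (A : Matrix κ α ℤ) (m : κ → ℤ) (a : K) :
    pullback K A (AddMonoidAlgebra.single m a) = AddMonoidAlgebra.single (m ᵥ* A) a := by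
  simp [pullback]

theorem eval_pullback (A : Matrix κ ι ℤ) (t : Torus K ι) (h : Laurent K κ) :
    Laurent.eval t (pullback K A h) = Laurent.eval (torusHom K A t) h := by
  induction h using AddMonoidAlgebra.induction_linear with
  | zero => simp
  | add f g hf hg => rw [map_add, map_add, map_add, hf, hg]
  | single m a => rw [pullback_single, eval_single, eval_single, chi_torusHom]

theorem eval_toLaurent [DecidableEq ι] (t : Torus K ι) (p : MvPolynomial ι K) :
    Laurent.eval t (toLaurent p) = MvPolynomial.eval (fun j => (t j : K)) p := by
  have : (Laurent.eval t).comp toLaurent = MvPolynomial.aeval (fun j => (t j : K)) := by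
    refine MvPolynomial.algHom_ext fun i => ?_
    rw [AlgHom.comp_apply, toLaurent, MvPolynomial.aeval_X, MvPolynomial.aeval_X, eval_single]
    simp [Torus.chi, Pi.single_apply]
  exact DFunLike.congr_fun this p

/-- The monomial relating `g` to the pullback of `h` has no zeros on the torus. -/
theorem IsPushForward.eval_eq_zero_iff {A : Matrix κ ι ℤ} {g : Laurent K ι} {h : Laurent K κ}
    (hgh : IsPushForward A g h) (t : Torus K ι) :
    Laurent.eval (torusHom K A t) h = 0 ↔ Laurent.eval t g = 0 := by
  obtain ⟨μ, hμ⟩ := hgh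
  rw [← eval_pullback, hμ, map_mul, eval_single, one_mul, mul_eq_zero]
  simp

theorem prod_single_one {α τ : Type*} (s : Finset τ) (a : τ → α → ℤ) :
    ∏ i ∈ s, (AddMonoidAlgebra.single (a i) 1 : Laurent K α) =
      AddMonoidAlgebra.single (∑ i ∈ s, a i) 1 := by
  classical
  induction s using Finset.induction_on with
  | empty => rfl
  | insert i s hi ih =>
    rw [Finset.prod_insert hi, Finset.sum_insert hi, ih, AddMonoidAlgebra.single_mul_single,
      one_mul]

theorem toLaurent_monomial [DecidableEq ι] (k : ι → ℕ) (c : K) :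
    toLaurent (MvPolynomial.monomial (Finsupp.equivFunOnFinite.symm k) c) =
      AddMonoidAlgebra.single (fun i => (k i : ℤ)) c := by
  rw [toLaurent, MvPolynomial.aeval_monomial, Finsupp.prod_fintype _ _ (by simp)]
  simp only [AddMonoidAlgebra.single_pow, one_pow, Finsupp.coe_equivFunOnFinite_symm]
  rw [prod_single_one]
  have : ∑ i, k i • (Pi.single i 1 : ι → ℤ) = fun i => (k i : ℤ) := by
    funext j
    simp [Finset.sum_apply, Pi.single_apply]
  rw [this, Algebra.algebraMap_eq_smul_one, smul_mul_assoc, one_mul, AddMonoidAlgebra.smul_single,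
    smul_eq_mul, mul_one]

/-- A Laurent polynomial becomes a polynomial after multiplication by a monomial. -/
theorem exists_monomial_mul_eq_toLaurent [DecidableEq ι] (f : Laurent K ι) :
    ∃ (μ : ι → ℕ) (p : MvPolynomial ι K),
      toLaurent p = AddMonoidAlgebra.single (fun i => (μ i : ℤ)) 1 * f := by
  induction f using AddMonoidAlgebra.induction_linear with
  | zero => exact ⟨0, 0, by simp⟩
  | add f g hf hg =>
    obtain ⟨μ, p, hp⟩ := hf
    obtain ⟨ν, q, hq⟩ := hg
    refine ⟨μ + ν, MvPolynomial.monomial (Finsupp.equivFunOnFinite.symm ν) 1 * p +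
      MvPolynomial.monomial (Finsupp.equivFunOnFinite.symm μ) 1 * q, ?_⟩
    have : (AddMonoidAlgebra.single (fun i => (((μ + ν) i : ℕ) : ℤ)) 1 : Laurent K ι) =
        AddMonoidAlgebra.single (fun i => (μ i : ℤ)) 1 *
          AddMonoidAlgebra.single (fun i => (ν i : ℤ)) 1 := by
      rw [AddMonoidAlgebra.single_mul_single, one_mul]
      congr 1
    rw [map_add, map_mul, map_mul, hp, hq, toLaurent_monomial, toLaurent_monomial, this]
    ring
  | single m a =>
    refine ⟨fun i => (-m i).toNat, MvPolynomial.monomial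
      (Finsupp.equivFunOnFinite.symm fun i => (m i).toNat) a, ?_⟩
    rw [toLaurent_monomial, AddMonoidAlgebra.single_mul_single, one_mul]
    congr 1
    funext i
    simp only [Pi.add_apply]
    omega

theorem single_mul_single_neg {α : Type*} (m : α → ℤ) :
    (AddMonoidAlgebra.single m 1 * AddMonoidAlgebra.single (-m) 1 : Laurent K α) = 1 := by
  rw [AddMonoidAlgebra.single_mul_single, add_neg_cancel, one_mul]
  rfl

theorem isUnit_single {α : Type*} (m : α → ℤ) : IsUnit (AddMonoidAlgebra.single m 1 : Laurent K α) :=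
  IsUnit.of_mul_eq_one _ (single_mul_single_neg m)

theorem mem_torusZeros_span {τ : Type*} (g : τ → Laurent K ι) (t : Torus K ι) :
    t ∈ torusZeros (Ideal.span (Set.range g)) ↔ ∀ i, Laurent.eval t (g i) = 0 := by
  constructor
  · exact fun h i => h _ (Ideal.subset_span ⟨i, rfl⟩)
  · intro h
    have : Ideal.span (Set.range g) ≤ RingHom.ker (Laurent.eval t) :=
      Ideal.span_le.2 (by rintro _ ⟨i, rfl⟩; exact h i)
    exact fun f hf => this hf

end Characters

/-! ### Algebraically closed fields -/

section AlgClosed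

variable {K : Type*} [Field K] [IsAlgClosed K] {ι κ : Type*} [Fintype ι] [Fintype κ]

/-- **Nullstellensatz** for Laurent polynomials. -/
theorem exists_pow_mem_of_forall_eval_eq_zero (𝔠 : Ideal (Laurent K ι)) (f : Laurent K ι)
    (hf : ∀ t ∈ torusZeros 𝔠, Laurent.eval t f = 0) : ∃ k : ℕ, f ^ k ∈ 𝔠 := by
  classical
  obtain ⟨μ, p, hp⟩ := exists_monomial_mul_eq_toLaurent f
  have hX : toLaurent (∏ i, MvPolynomial.X i : MvPolynomial ι K) =
      AddMonoidAlgebra.single (∑ i, Pi.single i 1) 1 := by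
    rw [map_prod, ← prod_single_one]
    exact Finset.prod_congr rfl fun i _ => MvPolynomial.aeval_X _ i
  -- The factor `∏ X i` kills the points with a zero coordinate; all others are torus points. So the
  -- affine Nullstellensatz applies to the contraction of `𝔠`, and the monomials are units
  -- afterwards.
  have hmem : p * ∏ i, MvPolynomial.X i ∈ (𝔠.comap (toLaurent (K := K) (ι := ι))).radical := by
    rw [← MvPolynomial.vanishingIdeal_zeroLocus_eq_radical (K := K)]
    intro x hx
    rw [map_mul, map_prod, mul_eq_zero, Finset.prod_eq_zero_iff, or_iff_not_imp_right]
    intro hne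
    push Not at hne
    simp only [MvPolynomial.aeval_X] at hne
    set t : Torus K ι := fun i => Units.mk0 (x i) (hne i (Finset.mem_univ i))
    have hev : ∀ q : MvPolynomial ι K, Laurent.eval t (toLaurent q) = MvPolynomial.aeval x q :=
      fun q => eval_toLaurent t q
    have ht : t ∈ torusZeros 𝔠 := by
      intro g hg
      obtain ⟨ν, q, hq⟩ := exists_monomial_mul_eq_toLaurent g
      have h0 : Laurent.eval t (toLaurent q) = 0 := by
        rw [hev]
        refine hx q ?_
        rw [Ideal.mem_comap, hq]
        exact 𝔠.mul_mem_left _ hg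
      rw [hq, map_mul, eval_single, one_mul] at h0
      exact (mul_eq_zero.1 h0).resolve_left (Units.ne_zero _)
    rw [← hev, hp, map_mul, hf t ht, mul_zero]
  obtain ⟨k, hk⟩ := hmem
  refine ⟨k, ?_⟩
  rw [Ideal.mem_comap, map_pow, map_mul, hp, hX, mul_right_comm, mul_pow] at hk
  exact (Ideal.unit_mul_mem_iff_mem 𝔠 (((isUnit_single _).mul (isUnit_single _)).pow k)).1 hk

/-- The zeros in the torus of a tuple of polynomials are detected by the product of variables. -/
theorem torusZerosPoly_nonempty_iff {τ : Type*} (h : τ → MvPolynomial ι K) :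
    (torusZerosPoly h).Nonempty ↔
      (∏ j, MvPolynomial.X j) ∉ (Ideal.span (Set.range h)).radical := by
  rw [← MvPolynomial.vanishingIdeal_zeroLocus_eq_radical (K := K),
    MvPolynomial.mem_vanishingIdeal_iff]
  push Not
  simp only [MvPolynomial.zeroLocus_span, map_prod, MvPolynomial.aeval_X, Finset.prod_ne_zero_iff]
  constructor
  · rintro ⟨t, ht⟩
    refine ⟨fun j => (t j : K), ?_, fun j _ => (t j).ne_zero⟩
    rintro _ ⟨i, rfl⟩
    exact ht i
  · rintro ⟨x, hx, hne⟩
    exact ⟨fun j => Units.mk0 (x j) (hne j (Finset.mem_univ j)), fun i => hx _ ⟨i, rfl⟩⟩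

/-- Roots exist in `K`, so `Kˣ` is divisible, and divisible abelian groups are injective:
homomorphisms into `Kˣ` extend along injections. -/
theorem baer_units : Module.Baer ℤ (Additive Kˣ) := by
  have hroot : ∀ {n : ℕ}, n ≠ 0 → Function.Surjective (fun a : Kˣ => a ^ n) := by
    intro n hn a
    obtain ⟨z, hz⟩ := IsAlgClosed.exists_pow_nat_eq (a : K) (Nat.pos_of_ne_zero hn)
    have hz0 : z ≠ 0 := by
      rintro rfl
      rw [zero_pow hn] at hz
      exact a.ne_zero hz.symm
    exact ⟨Units.mk0 z hz0, Units.ext (by simpa using hz)⟩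
  let _ : DivisibleBy (Additive Kˣ) ℕ := divisibleByOfSMulRightSurj _ _ fun {n} hn => hroot hn
  let _ : DivisibleBy (Additive Kˣ) ℤ := AddGroup.divisibleByIntOfDivisibleByNat _
  exact Module.Baer.of_divisible _

/-- A homomorphism of tori given by a matrix of full row rank is surjective. -/
theorem torusHom_surjective {A : Matrix κ ι ℤ} (hA : LinearIndependent ℤ A.row) :
    Function.Surjective (torusHom K A) := by
  classical
  intro y
  -- Full row rank makes `m ↦ m A` injective. Extending the character `m ↦ y^m` along it gives a
  -- preimage of `y`.
  obtain ⟨φ, hφ⟩ := baer_units.extension_property_addMonoidHom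
    (A.vecMulLinear.toAddMonoidHom) (vecMul_injective_iff.2 hA) (chiHom y)
  obtain ⟨t, rfl⟩ := exists_chiHom_eq φ
  refine ⟨t, funext fun j => ?_⟩
  have := DFunLike.congr_fun hφ (Pi.single j 1)
  simp only [AddMonoidHom.comp_apply, LinearMap.toAddMonoidHom_coe, vecMulLinear_apply,
    single_one_vecMul] at this
  refine (Additive.ofMul.injective this).trans ?_
  simp [Torus.chi, Pi.single_apply]

variable [CharZero K]

/-- `N` will be the order of a group element, with `0` for infinite order, where any unit other than
`1` serves. Characteristic zero matters: in characteristic `p`, `u ^ p = 1` forces `u = 1`. -/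
theorem exists_unit_pow_eq_one_ne_one {N : ℕ} (hN : N ≠ 1) : ∃ u : Kˣ, u ^ N = 1 ∧ u ≠ 1 := by
  rcases Nat.eq_zero_or_pos N with rfl | hpos
  · refine ⟨Units.mk0 2 two_ne_zero, pow_zero _, fun h => ?_⟩
    have := congrArg Units.val h
    simp at this
  · have : NeZero (N : K) := ⟨Nat.cast_ne_zero.2 hpos.ne'⟩
    have : NeZero N := ⟨hpos.ne'⟩
    obtain ⟨ζ, hζ⟩ := HasEnoughRootsOfUnity.exists_primitiveRoot K N
    obtain ⟨u, rfl⟩ := hζ.isUnit hpos.ne'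
    refine ⟨u, Units.ext (by simpa using hζ.pow_eq_one), ?_⟩
    rintro rfl
    exact hN (IsPrimitiveRoot.one_right_iff.1 (by simpa using hζ))

/-- An integral vector outside of a lattice is separated from it by a point of the torus. -/
theorem exists_chi_ne_one {L : AddSubgroup (ι → ℤ)} {m : ι → ℤ} (hm : m ∉ L) :
    ∃ t : Torus K ι, (∀ l ∈ L, t.chi l = 1) ∧ t.chi m ≠ 1 := by
  set a : (ι → ℤ) ⧸ L := QuotientAddGroup.mk m with ha
  have ha0 : a ≠ 0 := fun h => hm ((QuotientAddGroup.eq_zero_iff m).1 h)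
  obtain ⟨u, hu, hu1⟩ := exists_unit_pow_eq_one_ne_one (K := K)
    (fun h => ha0 (AddMonoid.addOrderOf_eq_one_iff.1 h))
  -- `ψ` sends the generator of the cyclic group spanned by the class of `m` to `u ≠ 1`; injectivity
  -- of `Kˣ` extends this to the whole quotient by `L`.
  let ψ : (ℤ ⧸ Ideal.span {(addOrderOf a : ℤ)}) →ₗ[ℤ] Additive Kˣ :=
    Submodule.liftQSpanSingleton _ (LinearMap.toSpanSingleton ℤ _ (Additive.ofMul u)) (by
      rw [LinearMap.toSpanSingleton_apply, natCast_zsmul, ← ofMul_pow, hu]; rfl)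
  obtain ⟨φ, hφ⟩ := baer_units.extension_property (ℤ ∙ a).subtype Subtype.val_injective
    (ψ ∘ₗ (CharacterModule.intSpanEquivQuotAddOrderOf a).toLinearMap)
  obtain ⟨t, ht⟩ := exists_chiHom_eq (φ.toAddMonoidHom.comp (QuotientAddGroup.mk' L))
  refine ⟨t, fun l hl => ?_, fun h => hu1 ?_⟩
  · have h1 : chiHom t l = 0 := by
      rw [ht]
      simp [(QuotientAddGroup.eq_zero_iff l).2 hl]
    exact h1
  · have h1 : chiHom t m = φ a := by rw [ht]; rfl
    have h2 := LinearMap.congr_fun hφ ⟨a, Submodule.mem_span_singleton_self a⟩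
    simp only [LinearMap.comp_apply, LinearEquiv.coe_coe,
      CharacterModule.intSpanEquivQuotAddOrderOf_apply_self] at h2
    have h3 : ψ (Submodule.Quotient.mk 1) = Additive.ofMul u :=
      (Submodule.liftQ_apply _ _ _).trans (one_smul ℤ _)
    have h4 : chiHom t m = Additive.ofMul u := h1.trans (h2.trans h3)
    exact (Additive.ofMul.injective h4).symm.trans h

end AlgClosed

/-! ### Quotients by subgroups -/

/-- Independence of characters, for a family of characters that may contain repetitions. -/
theorem sum_filter_eq_zero {K G τ : Type*} [Field K] [Monoid G] [DecidableEq (G →* K)]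
    (S : Finset τ) (χ : τ → G →* K) (a : τ → K) (h : ∀ x, ∑ i ∈ S, a i * χ i x = 0)
    (ψ : G →* K) : ∑ i ∈ S with χ i = ψ, a i = 0 := by
  by_cases hψ : ψ ∈ S.image χ
  · refine linearIndependent_iff'.1 (linearIndependent_monoidHom G K) (S.image χ)
      (fun ψ => ∑ i ∈ S with χ i = ψ, a i) ?_ ψ hψ
    funext x
    simp only [Finset.sum_apply, Pi.smul_apply, smul_eq_mul, Pi.zero_apply]
    rw [← h x, ← Finset.sum_fiberwise_of_maps_to (fun i hi => Finset.mem_image_of_mem χ hi)]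
    refine Finset.sum_congr rfl fun φ _ => ?_
    rw [Finset.sum_mul]
    exact Finset.sum_congr rfl fun i hi => by rw [(Finset.mem_filter.1 hi).2]
  · rw [Finset.filter_false_of_mem, Finset.sum_empty]
    rintro i hi rfl
    exact hψ (Finset.mem_image_of_mem χ hi)

section Field

variable {K : Type*} [Field K] {ι : Type*} [Fintype ι]

/-- The exponents of the characters that are trivial on a subgroup. -/
def trivialExponents (H : Subgroup (Torus K ι)) : AddSubgroup (ι → ℤ) where
  carrier := {m | ∀ t ∈ H, t.chi m = 1}
  zero_mem' t _ := chi_zero t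
  add_mem' ha hb t ht := by rw [chi_add, ha t ht, hb t ht, one_mul]
  neg_mem' ha t ht := by rw [chi_neg, ha t ht, inv_one]

/-- Tells when two monomials have the same weight under `H`; grouping terms by restricted character
yields the homogeneous components. -/
theorem charHom_comp_subtype_eq_iff (H : Subgroup (Torus K ι)) (m m' : ι → ℤ) :
    (charHom m).comp H.subtype = (charHom (K := K) m').comp H.subtype ↔
      m - m' ∈ trivialExponents H := by
  constructor
  · intro h t ht
    have := DFunLike.congr_fun h (⟨t, ht⟩ : H)
    rw [chi_sub, div_eq_one]
    exact Units.ext this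
  · intro h
    ext t
    have := h t t.2
    rw [chi_sub, div_eq_one] at this
    exact congrArg Units.val this

/-- A function which vanishes on a subgroup also vanishes at the points at which all characters
are trivial that are trivial on the subgroup. -/
theorem sum_eq_zero_of_forall_mem (H : Subgroup (Torus K ι)) (S : Finset (ι → ℤ))
    (a : (ι → ℤ) → K) (h : ∀ x ∈ H, ∑ m ∈ S, a m * x.chi m = 0) (t : Torus K ι)
    (ht : ∀ m ∈ trivialExponents H, t.chi m = 1) : ∑ m ∈ S, a m * t.chi m = 0 := by
  classical
  let χ : (ι → ℤ) → H →* K := fun m => (charHom m).comp H.subtype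
  rw [← Finset.sum_fiberwise_of_maps_to (fun m hm => Finset.mem_image_of_mem χ hm)]
  refine Finset.sum_eq_zero fun ψ hψ => ?_
  obtain ⟨m₀, -, rfl⟩ := Finset.mem_image.1 hψ
  -- On `H`, independence of characters makes the coefficients of each weight sum to zero, while `t`
  -- takes a single value on all exponents of one weight.
  have h0 := sum_filter_eq_zero S χ a (fun x => h x x.2) (χ m₀)
  calc ∑ m ∈ S with χ m = χ m₀, a m * (t.chi m : K)
      = ∑ m ∈ S with χ m = χ m₀, a m * (t.chi m₀ : K) := by
        refine Finset.sum_congr rfl fun m hm => ?_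
        have := ht _ ((charHom_comp_subtype_eq_iff H m m₀).1 (Finset.mem_filter.1 hm).2)
        rw [chi_sub, div_eq_one] at this
        rw [this]
    _ = 0 := by rw [← Finset.sum_mul, h0, zero_mul]

theorem eval_mul (t v : Torus K ι) (g : Laurent K ι) :
    Laurent.eval (t * v) g = ∑ m ∈ g.coeff.support, g.coeff m * v.chi m * t.chi m := by
  rw [eval_eq_sum]
  refine Finset.sum_congr rfl fun m _ => ?_
  rw [mul_chi, Units.val_mul]
  ring

theorem mem_maxInvariantSubgroup (𝔠 : Ideal (Laurent K ι)) (t : Torus K ι) :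
    t ∈ maxInvariantSubgroup 𝔠 ↔ ∀ v, t * v ∈ torusZeros 𝔠 ↔ v ∈ torusZeros 𝔠 := by
  rw [maxInvariantSubgroup, MulAction.mem_stabilizer_set]
  rfl

/-- The maximal invariant subgroup is closed: it is cut out by characters. -/
theorem mem_maxInvariantSubgroup_of_trivialExponents (𝔠 : Ideal (Laurent K ι)) (t : Torus K ι)
    (ht : ∀ m ∈ trivialExponents (maxInvariantSubgroup 𝔠), t.chi m = 1) :
    t ∈ maxInvariantSubgroup 𝔠 := by
  have key : ∀ u : Torus K ι, (∀ m ∈ trivialExponents (maxInvariantSubgroup 𝔠), u.chi m = 1) →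
      ∀ v ∈ torusZeros 𝔠, u * v ∈ torusZeros 𝔠 := by
    intro u hu v hv g hg
    rw [eval_mul]
    -- For fixed `v`, the function `x ↦ g(x v)` is a Laurent polynomial in `x` that vanishes on the
    -- subgroup.
    refine sum_eq_zero_of_forall_mem (maxInvariantSubgroup 𝔠) _ _ (fun x hx => ?_) u hu
    rw [← eval_mul]
    exact ((mem_maxInvariantSubgroup 𝔠 x).1 hx v).2 hv g hg
  rw [mem_maxInvariantSubgroup]
  refine fun v => ⟨fun h => ?_, key t ht v⟩
  have := key t⁻¹ (fun m hm => ?_) _ h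
  · rwa [inv_mul_cancel_left] at this
  · have h1 := mul_chi t⁻¹ t m
    rwa [inv_mul_cancel, one_chi, ht m hm, mul_one, eq_comm] at h1

/-- The quotient by the maximal invariant subgroup is described by an integral matrix. -/
theorem exists_describesQuotient (𝔠 : Ideal (Laurent K ι)) :
    ∃ (n : ℕ) (P : Matrix (Fin n) ι ℤ), DescribesQuotient P (maxInvariantSubgroup 𝔠) := by
  classical
  set M := (trivialExponents (maxInvariantSubgroup 𝔠)).toIntSubmodule
  -- A subgroup of the free group `ℤ^ι` is free of finite rank; its basis vectors become the rows of
  -- `P`.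
  obtain ⟨n, ⟨b⟩⟩ := Submodule.nonempty_basis_of_pid (Pi.basisFun ℤ ι) M
  refine ⟨n, Matrix.of fun j => (b j : ι → ℤ), ?_, le_antisymm (fun t ht => ?_) fun t ht => ?_⟩
  · exact b.linearIndependent.map' M.subtype M.ker_subtype
  · refine mem_maxInvariantSubgroup_of_trivialExponents 𝔠 t fun m hm => ?_
    rw [mem_ker_torusHom] at ht
    have h1 := ht (b.repr ⟨m, hm⟩)
    have h2 : (b.repr ⟨m, hm⟩ : Fin n → ℤ) ᵥ* Matrix.of (fun j => (b j : ι → ℤ)) = m := by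
      rw [vecMul_eq_sum]
      have h3 := congrArg (M.subtype) (b.sum_repr ⟨m, hm⟩)
      rw [map_sum] at h3
      exact h3
    rwa [h2] at h1
  · rw [MonoidHom.mem_ker]
    exact funext fun j => (b j).2 t ht

end Field

/-- The image of a closed set under a surjective homomorphism of tori, if its equations have
push-forwards. -/
theorem image_torusZeros_eq_torusZerosPoly {K : Type*} [Field K] [IsAlgClosed K]
    {ι κ : Type*} [Fintype ι] [Fintype κ] {τ : Type*} [DecidableEq κ] (g : τ → Laurent K ι)
    (A : Matrix κ ι ℤ) (hA : LinearIndependent ℤ A.row) (h : τ → MvPolynomial κ K)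
    (hgh : ∀ i, IsPushForward A (g i) (toLaurent (h i))) :
    torusHom K A '' torusZeros (Ideal.span (Set.range g)) = torusZerosPoly h := by
  -- The zero set upstairs is a full preimage; no invariance hypothesis is needed.
  have key : ∀ t, torusHom K A t ∈ torusZerosPoly h ↔
      t ∈ torusZeros (Ideal.span (Set.range g)) := fun t => by
    rw [mem_torusZeros_span]
    refine forall_congr' fun i => ?_
    rw [← (hgh i).eval_eq_zero_iff t, eval_toLaurent]
  ext y
  obtain ⟨t, rfl⟩ := torusHom_surjective (K := K) hA y
  constructor
  · rintro ⟨u, hu, hut⟩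
    rw [← hut]
    exact (key u).2 hu
  · exact fun hy => ⟨t, (key t).1 hy, rfl⟩

/-! ### Images under quotient maps and semi-invariance over algebraically closed fields of
characteristic zero -/

section AlgClosed

variable {K : Type*} [Field K] [IsAlgClosed K] [CharZero K] {ι κ : Type*} [Fintype ι] [Fintype κ]

/-- A character that is trivial on the kernel of `torusHom K A` is a pullback. -/
theorem exists_vecMul_eq_of_forall_ker (A : Matrix κ ι ℤ) (m : ι → ℤ)
    (h : ∀ t ∈ (torusHom K A).ker, t.chi m = 1) : ∃ l, l ᵥ* A = m := by
  by_contra hm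
  obtain ⟨t, ht, hne⟩ := exists_chi_ne_one (K := K)
    (L := (A.vecMulLinear.toAddMonoidHom).range) (m := m) hm
  exact hne (h t ((mem_ker_torusHom A t).2 fun l => ht _ ⟨l, rfl⟩))

/-- The image of an invariant closed set under a quotient map is cut out by push-forwards. -/
theorem image_torusZeros_eq_pushIdeal (𝔠 : Ideal (Laurent K ι)) (A : Matrix κ ι ℤ)
    (hA : LinearIndependent ℤ A.row) (hker : (torusHom K A).ker ≤ maxInvariantSubgroup 𝔠) :
    torusHom K A '' torusZeros 𝔠 = torusZeros (pushIdeal A 𝔠) := by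
  classical
  refine Set.Subset.antisymm ?_ fun y hy => ?_
  · rintro _ ⟨t, ht, rfl⟩ h hh
    have : pushIdeal A 𝔠 ≤ RingHom.ker (Laurent.eval (torusHom K A t)) :=
      Ideal.span_le.2 fun h ⟨g, hg, hgh⟩ => (hgh.eval_eq_zero_iff t).2 (ht g hg)
    exact this hh
  obtain ⟨t, rfl⟩ := torusHom_surjective hA y
  -- Any preimage `t` of `y` already lies in `V`; this is checked on the weight components of `f`
  -- separately.
  refine ⟨t, fun f hf => ?_, rfl⟩
  set H := (torusHom K A).ker with hH
  let χ : (ι → ℤ) → H →* K := fun m => (charHom m).comp H.subtype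
  rw [eval_eq_sum, ← Finset.sum_fiberwise_of_maps_to
    (fun m hm => Finset.mem_image_of_mem χ hm)]
  refine Finset.sum_eq_zero fun ψ hψ => ?_
  obtain ⟨m₀, -, rfl⟩ := Finset.mem_image.1 hψ
  have hl : ∀ m, χ m = χ m₀ → ∃ l, l ᵥ* A = m - m₀ := fun m hm =>
    exists_vecMul_eq_of_forall_ker A _ ((charHom_comp_subtype_eq_iff H m m₀).1 hm)
  choose! l hl using hl
  -- the homogeneous component of `f` and its push-forward
  set S := f.coeff.support.filter fun m => χ m = χ m₀ with hS
  set f₀ : Laurent K ι := ∑ m ∈ S, AddMonoidAlgebra.single m (f.coeff m) with hf₀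
  set q : Laurent K κ := ∑ m ∈ S, AddMonoidAlgebra.single (l m) (f.coeff m) with hq
  have heval : ∀ x : Torus K ι, Laurent.eval x f₀ = ∑ m ∈ S, f.coeff m * (x.chi m : K) :=
    fun x => by
      rw [hf₀, map_sum]
      exact Finset.sum_congr rfl fun m _ => eval_single x m _
  have hpull : pullback K A q = AddMonoidAlgebra.single (-m₀) 1 * f₀ := by
    rw [hq, hf₀, map_sum, Finset.mul_sum]
    refine Finset.sum_congr rfl fun m hm => ?_
    rw [pullback_single, hl m (Finset.mem_filter.1 hm).2, AddMonoidAlgebra.single_mul_single,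
      one_mul, sub_eq_neg_add]
  -- `f` vanishes on the whole `H`-orbit of `v`, so by independence of characters its component
  -- vanishes at `v`.
  have hvan : ∀ v ∈ torusZeros 𝔠, Laurent.eval v f₀ = 0 := by
    intro v hv
    rw [heval]
    refine sum_filter_eq_zero f.coeff.support χ (fun m => f.coeff m * (v.chi m : K))
      (fun x => ?_) (χ m₀)
    have := ((mem_maxInvariantSubgroup 𝔠 _).1 (hker x.2) v).2 hv f hf
    rwa [eval_mul] at this
  -- Only the zero set is known to be invariant, not `𝔠`, so the component itself need not lie in
  -- `𝔠`; a power of it does.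
  obtain ⟨k, hk⟩ := exists_pow_mem_of_forall_eval_eq_zero 𝔠 f₀ hvan
  have hpush : IsPushForward A (f₀ ^ k) (q ^ k) :=
    ⟨k • -m₀, by rw [map_pow, hpull, mul_pow, AddMonoidAlgebra.single_pow, one_pow]⟩
  have h1 := (hpush.eval_eq_zero_iff t).1 (hy _ (Ideal.subset_span ⟨_, hk, hpush⟩))
  rw [map_pow] at h1
  rw [← heval]
  exact eq_zero_of_pow_eq_zero h1

/-! ### Semi-invariants -/

theorem charHom_injective : Function.Injective (charHom : (ι → ℤ) → Torus K ι →* K) := by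
  intro m m' h
  by_contra hne
  obtain ⟨t, -, ht⟩ := exists_chi_ne_one (K := K) (L := ⊥) (m := m - m')
    (by simpa [sub_eq_zero] using hne)
  rw [chi_sub, ne_eq, div_eq_one] at ht
  exact ht (Units.ext (DFunLike.congr_fun h t))

/-- Comparing coefficients in `g(t x) = c g(x)`, by independence of characters, forces `t^m = c` for
every exponent `m` of `g`. -/
theorem isSemiInvariant_iff (t : Torus K ι) (g : Laurent K ι) :
    IsSemiInvariant t g ↔
      ∀ m m', g.coeff m ≠ 0 → g.coeff m' ≠ 0 → t.chi m = t.chi m' := by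
  classical
  constructor
  · rintro ⟨c, hc⟩
    have key : ∀ m, g.coeff m ≠ 0 → t.chi m = c := by
      intro m hm
      have h := sum_filter_eq_zero g.coeff.support (charHom : _ → Torus K ι →* K)
        (fun m => g.coeff m * (t.chi m - c)) (fun x => ?_) (charHom m)
      · simp only [charHom_injective.eq_iff] at h
        rw [Finset.filter_eq', if_pos (Finsupp.mem_support_iff.2 hm), Finset.sum_singleton,
          mul_eq_zero, sub_eq_zero] at h
        exact Units.ext (h.resolve_left hm)
      · have := hc x
        rw [mul_comm t x, eval_mul, eval_eq_sum, Finset.mul_sum, ← sub_eq_zero,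
          ← Finset.sum_sub_distrib] at this
        rw [← this]
        exact Finset.sum_congr rfl fun m _ => by
          simp only [charHom, MonoidHom.coe_mk, OneHom.coe_mk]
          ring
    exact fun m m' hm hm' => (key m hm).trans (key m' hm').symm
  · intro h
    by_cases hg : g = 0
    · exact ⟨1, fun x => by simp [hg]⟩
    · obtain ⟨m₀, hm₀⟩ : ∃ m, g.coeff m ≠ 0 := by
        by_contra! h0
        exact hg (AddMonoidAlgebra.coeff_eq_zero.1 (Finsupp.ext h0))
      refine ⟨t.chi m₀, fun x => ?_⟩
      rw [eval_eq_sum, eval_eq_sum, Finset.mul_sum]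
      refine Finset.sum_congr rfl fun m hm => ?_
      rw [mul_chi, h m m₀ (Finsupp.mem_support_iff.1 hm) hm₀, Units.val_mul]
      ring

end AlgClosed

/-! ### Faces -/

section Faces

variable {K : Type*} [Field K] {r : ℕ}

theorem eval_faceReduce (γ₀ : PointedCone ℚ (Fin r → ℚ)) (t : FaceTorus K γ₀) (x : Fin r → K)
    (hx : ∀ i, x i = if hi : i ∈ faceIndex γ₀ then (t ⟨i, hi⟩ : K) else 0)
    (f : MvPolynomial (Fin r) K) :
    MvPolynomial.eval (fun j => (t j : K)) (faceReduce γ₀ f) = MvPolynomial.eval x f := by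
  have : (MvPolynomial.aeval (R := K) fun j => (t j : K)).comp (faceReduce γ₀) =
      MvPolynomial.aeval x := by
    refine MvPolynomial.algHom_ext fun i => ?_
    rw [AlgHom.comp_apply, faceReduce, MvPolynomial.aeval_X, MvPolynomial.aeval_X, hx]
    split_ifs <;> simp
  exact DFunLike.congr_fun this f

theorem faceLaurentIdeal_span {τ : Type*} (f : τ → MvPolynomial (Fin r) K)
    (γ₀ : PointedCone ℚ (Fin r → ℚ)) :
    faceLaurentIdeal (Ideal.span (Set.range f)) γ₀ =
      Ideal.span (Set.range fun i => toLaurent (faceReduce γ₀ (f i))) := by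
  have h : faceIdeal (Ideal.span (Set.range f)) γ₀ =
      (Ideal.span (Set.range f)).map (faceReduce γ₀) := rfl
  rw [faceLaurentIdeal, h, Ideal.map_span, Ideal.map_span, ← Set.range_comp, ← Set.range_comp]
  rfl

theorem isAFace_iff_nonempty (𝔞 : Ideal (MvPolynomial (Fin r) K))
    (γ₀ : PointedCone ℚ (Fin r → ℚ)) :
    IsAFace 𝔞 γ₀ ↔ (torusZeros (faceLaurentIdeal 𝔞 γ₀)).Nonempty := by
  have key : ∀ t : FaceTorus K γ₀, t ∈ torusZeros (faceLaurentIdeal 𝔞 γ₀) ↔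
      ∀ f ∈ 𝔞, MvPolynomial.eval (fun j => (t j : K)) (faceReduce γ₀ f) = 0 := by
    intro t
    constructor
    · intro h f hf
      rw [← eval_toLaurent]
      exact h _ (Ideal.mem_map_of_mem _ (Ideal.subset_span ⟨f, hf, rfl⟩))
    · intro h
      have : faceLaurentIdeal 𝔞 γ₀ ≤ RingHom.ker (Laurent.eval t) := by
        refine Ideal.map_le_iff_le_comap.2 (Ideal.span_le.2 ?_)
        rintro _ ⟨f, hf, rfl⟩
        exact (eval_toLaurent t _).trans (h f hf)
      exact fun g hg => this hg
  constructor
  · rintro ⟨x, ⟨t, ht⟩, hx⟩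
    refine ⟨fun j => t j, (key _).2 fun f hf => ?_⟩
    rw [eval_faceReduce γ₀ _ x (fun i => by rw [ht]; split_ifs <;> rfl), hx f hf]
  · rintro ⟨t, ht⟩
    refine ⟨fun i => if hi : i ∈ faceIndex γ₀ then (t ⟨i, hi⟩ : K) else 0,
      -- Coordinates off the face do not affect the orbit point; `1` fills them.
      ⟨fun i => if hi : i ∈ faceIndex γ₀ then t ⟨i, hi⟩ else 1, fun i => ?_⟩, fun f hf => ?_⟩
    · by_cases hi : i ∈ faceIndex γ₀ <;> simp [hi]
    · rw [← eval_faceReduce γ₀ t _ (fun i => rfl)]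
      exact (key t).1 ht f hf

end Faces

/-! ### The exponent matrices -/

/-- In the pivot column of the first row with non-zero coefficient, earlier rows have coefficient
zero and later rows have entry zero. -/
theorem IsHermiteNormalForm.linearIndependent {ι : Type*} [LinearOrder ι] [Fintype ι] {N n : ℕ}
    {hn : n ≤ N} {D : Matrix (Fin N) ι ℤ} (h : IsHermiteNormalForm hn D) :
    LinearIndependent ℤ (upperRows hn D).row := by
  obtain ⟨p, hp, hech⟩ := h.echelon
  rw [Fintype.linearIndependent_iff]
  intro c hc
  by_contra! hne
  obtain ⟨a, ha, hmin⟩ := WellFounded.has_min (wellFounded_lt (α := Fin n)) {a | c a ≠ 0} hne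
  have h0 := congrFun hc (p a)
  rw [Finset.sum_apply, Finset.sum_eq_single a] at h0
  · exact ha ((mul_eq_zero.1 h0).resolve_right (hech a).1.ne')
  · intro b _ hba
    rcases lt_or_gt_of_ne hba with hb | hb
    · have : c b = 0 := by
        by_contra h
        exact hmin b h hb
      simp [this]
    · exact mul_eq_zero_of_right _ ((hech b).2.1 _ (hp hb))
  · simp

/-- A matrix and the non-zero rows of its Hermite normal form generate the same lattice. -/
theorem IsHermiteNormalForm.exists_factorizations {ι : Type*} [LinearOrder ι] {N n : ℕ}
    {hn : n ≤ N} {A D : Matrix (Fin N) ι ℤ} {U : Matrix (Fin N) (Fin N) ℤ} (hU : IsUnit U.det)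
    (hD : D = U * A) (h : IsHermiteNormalForm hn D) :
    ∃ (C : Matrix (Fin N) (Fin n) ℤ) (W : Matrix (Fin n) (Fin N) ℤ),
      A = C * upperRows hn D ∧ upperRows hn D = W * A := by
  -- In `A = U⁻¹ D` only the first `n` columns of `U⁻¹` matter, since the lower rows of `D` vanish.
  refine ⟨U⁻¹.submatrix id (Fin.castLE hn), U.submatrix (Fin.castLE hn) id, ?_, ?_⟩
  · ext i j
    conv_lhs => rw [← Matrix.nonsing_inv_mul_cancel_left U A hU, ← hD, Matrix.mul_apply]
    refine (Fintype.sum_of_injective (Fin.castLE hn) (Fin.castLE_injective hn) _ _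
      (fun b hb => ?_) fun _ => rfl).symm
    rw [h.lower_rows_zero b _ j, mul_zero]
    by_contra! hlt
    exact hb ⟨⟨b.val, hlt⟩, rfl⟩
  · subst hD
    rfl

theorem diffMatrix_apply {ι : Type*} (ν : List (ι → ℤ)) (j : Fin (ν.length - 1)) :
    diffMatrix ν j =
      ν.get ⟨j.val + 1, by omega⟩ - ν.get ⟨0, by have := j.isLt; omega⟩ := rfl

theorem stackMatrix_apply {ι : Type*} {s : ℕ} (ν : Fin s → List (ι → ℤ)) (i : Fin s)
    (j : Fin ((ν i).length - 1)) :
    stackMatrix ν (finSigmaFinEquiv ⟨i, j⟩) = diffMatrix (ν i) j :=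
  congrArg (fun x : (i : Fin s) × Fin ((ν i).length - 1) => diffMatrix (ν x.1) x.2)
    ((finSigmaFinEquiv (n := fun i => (ν i).length - 1)).symm_apply_apply ⟨i, j⟩)

/-! ### Push-forwards and semi-invariance in terms of exponent lists -/

section Terms

variable {K : Type*} [Field K] {ι : Type*}

theorem sum_terms_eq {g : Laurent K ι} {ν : List (ι → ℤ)} (hν : IsTermList g ν) :
    ∑ j : Fin ν.length, AddMonoidAlgebra.single (ν.get j) (g.coeff (ν.get j)) = g := by
  conv_rhs => rw [← AddMonoidAlgebra.sum_coeff_single g, Finsupp.sum]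
  refine Finset.sum_bij (fun j _ => ν.get j) (fun j _ => ?_) (fun i _ j _ h => ?_)
    (fun m hm => ?_) fun _ _ => rfl
  · exact Finsupp.mem_support_iff.2 ((hν.2 _).1 (ν.get_mem j))
  · exact List.nodup_iff_injective_get.1 hν.1 h
  · obtain ⟨j, hj⟩ := List.mem_iff_get.1 ((hν.2 m).2 (Finsupp.mem_support_iff.1 hm))
    exact ⟨j, Finset.mem_univ _, hj⟩

/-- The push-forward of the terms of `g`. -/
theorem isPushForward_pushTerms {n : ℕ} {g : Laurent K ι} {ν : List (ι → ℤ)}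
    (hν : IsTermList g ν) {P : Matrix (Fin n) ι ℤ} {B : Matrix (Fin (ν.length - 1)) (Fin n) ℤ}
    (hB : diffMatrix ν = B * P) (μ : Fin n → ℤ) :
    IsPushForward P g (AddMonoidAlgebra.single μ 1 * pushTerms g ν B) := by
  rcases Nat.eq_zero_or_pos ν.length with h0 | hpos
  · have hg : g = 0 := by
      rw [← sum_terms_eq hν]
      exact Finset.sum_eq_zero fun j _ => absurd j.isLt (by omega)
    refine ⟨0, ?_⟩
    simp [hg, pushTerms]
  -- The pullback of `T^{B_j}` is `T^{ν_j - ν_0}`, so the monomial is `T^{μ P - ν_0}`. The case `g =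
  -- 0`, which has no `ν_0`, was split off.
  refine ⟨μ ᵥ* P + -ν.get ⟨0, hpos⟩, ?_⟩
  conv_rhs => rw [← sum_terms_eq hν]
  rw [map_mul, pullback_single, pushTerms, map_sum, Finset.mul_sum, Finset.mul_sum]
  refine Finset.sum_congr rfl fun j _ => ?_
  rw [pullback_single, AddMonoidAlgebra.single_mul_single, AddMonoidAlgebra.single_mul_single,
    add_assoc]
  congr 2
  split_ifs with hj
  · have : j = ⟨0, hpos⟩ := Fin.ext hj
    rw [this, zero_vecMul, neg_add_cancel]
  · have h1 : B ⟨j.val - 1, by omega⟩ ᵥ* P = diffMatrix ν ⟨j.val - 1, by omega⟩ := by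
      rw [hB]; rfl
    rw [h1, diffMatrix_apply, sub_eq_neg_add]
    have h2 : (⟨j.val - 1 + 1, by omega⟩ : Fin ν.length) = j :=
      Fin.ext (Nat.sub_add_cancel (Nat.pos_of_ne_zero hj))
    exact congrArg (fun k => -ν.get ⟨0, hpos⟩ + ν.get k) h2

theorem isSemiInvariant_iff_diffMatrix [IsAlgClosed K] [CharZero K] [Fintype ι]
    {g : Laurent K ι} {ν : List (ι → ℤ)} (hν : IsTermList g ν) (t : Torus K ι) :
    IsSemiInvariant t g ↔ ∀ j, t.chi (diffMatrix ν j) = 1 := by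
  rw [isSemiInvariant_iff]
  constructor
  · intro h j
    rw [diffMatrix_apply, chi_sub, div_eq_one]
    exact h _ _ ((hν.2 _).1 (ν.get_mem _)) ((hν.2 _).1 (ν.get_mem _))
  · intro h
    have key : ∀ j : Fin ν.length, t.chi (ν.get j) = t.chi (ν.get ⟨0, (Nat.zero_le _).trans_lt j.isLt⟩) := by
      intro j
      rcases Nat.eq_zero_or_pos j.val with hj | hj
      · exact congrArg (fun i => t.chi (ν.get i)) (Fin.ext hj)
      · have := h ⟨j.val - 1, by omega⟩
        rw [diffMatrix_apply, chi_sub, div_eq_one] at this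
        rw [← this]
        exact congrArg (fun i => t.chi (ν.get i)) (Fin.ext (by simp only; omega))
    intro m m' hm hm'
    obtain ⟨j, rfl⟩ := List.mem_iff_get.1 ((hν.2 m).2 hm)
    obtain ⟨j', rfl⟩ := List.mem_iff_get.1 ((hν.2 m').2 hm')
    rw [key j, key j']

theorem mem_ker_torusHom_stackMatrix [Fintype ι] {s : ℕ} (ν : Fin s → List (ι → ℤ))
    (t : Torus K ι) :
    t ∈ (torusHom K (stackMatrix ν)).ker ↔ ∀ i j, t.chi (diffMatrix (ν i) j) = 1 := by
  rw [MonoidHom.mem_ker]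
  constructor
  · intro h i j
    have := congrFun h (finSigmaFinEquiv ⟨i, j⟩)
    change t.chi (stackMatrix ν _) = 1 at this
    rw [stackMatrix_apply] at this
    exact this
  · intro h
    exact funext fun a => h _ _

/-- Source of the integrality of `B_i`: it is the block of rows of `C` that belongs to `g_i`. -/
theorem exists_diffMatrix_eq_mul {s n : ℕ} {ν : Fin s → List (ι → ℤ)} {P : Matrix (Fin n) ι ℤ}
    {C : Matrix (Fin (rowCount ν)) (Fin n) ℤ} (hC : stackMatrix ν = C * P) (i : Fin s) :
    ∃ B : Matrix (Fin ((ν i).length - 1)) (Fin n) ℤ, diffMatrix (ν i) = B * P := by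
  refine ⟨Matrix.of fun j => C (finSigmaFinEquiv ⟨i, j⟩), ?_⟩
  funext j
  have := congrFun hC (finSigmaFinEquiv ⟨i, j⟩)
  rw [stackMatrix_apply] at this
  exact this

/-- The homomorphism of `C * A` factors through that of `A`. -/
theorem ker_torusHom_le_of_factor [Fintype ι] {α β : Type*} [Fintype α] [Fintype β]
    {A : Matrix α ι ℤ} {B : Matrix β ι ℤ} {C : Matrix β α ℤ} (h : B = C * A) :
    (torusHom K A).ker ≤ (torusHom K B).ker := by
  intro t ht
  rw [mem_ker_torusHom] at ht ⊢
  intro m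
  rw [h, ← vecMul_vecMul]
  exact ht _

/-- A point with respect to which all equations are semi-invariant preserves their zero set. -/
theorem mem_maxInvariantSubgroup_of_isSemiInvariant [Fintype ι] {τ : Type*}
    (g : τ → Laurent K ι) {t : Torus K ι} (h : ∀ i, IsSemiInvariant t (g i)) :
    t ∈ maxInvariantSubgroup (Ideal.span (Set.range g)) := by
  rw [mem_maxInvariantSubgroup]
  intro v
  rw [mem_torusZeros_span, mem_torusZeros_span]
  refine forall_congr' fun i => ?_
  obtain ⟨c, hc⟩ := h i
  rw [hc, mul_eq_zero, or_iff_right c.ne_zero]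

end Terms

end GITFan

end

/-! ### The face test and the algorithm -/

theorem mainTheorem3 {K : Type*} [Field K] [IsAlgClosed K] [CharZero K] {r s : ℕ}
    (f : Fin s → MvPolynomial (Fin r) K) (𝔞 : Ideal (MvPolynomial (Fin r) K))
    (h𝔞 : 𝔞 = Ideal.span (Set.range f))
    (γ₀ : PointedCone ℚ (Fin r → ℚ)) (hγ₀ : γ₀.IsFaceOf (GITFan.orthant r))
    (g : Fin s → GITFan.FacePoly K γ₀) (hg : ∀ i, g i = GITFan.faceReduce γ₀ (f i))
    (𝔠 : Ideal (GITFan.Laurent K (GITFan.faceIndex γ₀)))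
    (h𝔠 : 𝔠 = GITFan.faceLaurentIdeal 𝔞 γ₀)
    (H : Subgroup (GITFan.FaceTorus K γ₀)) (hH : H = GITFan.maxInvariantSubgroup 𝔠) :
    -- The quotient of the orbit by `H(γ₀)` is a torus with quotient map given by a matrix.
    (∃ (n : ℕ) (P : Matrix (Fin n) (GITFan.faceIndex γ₀) ℤ), GITFan.DescribesQuotient P H) ∧
    -- Test on the quotient by `H(γ₀)`.
    (∀ (n : ℕ) (P : Matrix (Fin n) (GITFan.faceIndex γ₀) ℤ), GITFan.DescribesQuotient P H →
      GITFan.torusHom K P '' GITFan.torusZeros 𝔠 =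
        GITFan.torusZeros (GITFan.pushIdeal P 𝔠) ∧
      (GITFan.IsAFace 𝔞 γ₀ ↔ (GITFan.torusZeros (GITFan.pushIdeal P 𝔠)).Nonempty) ∧
      ∀ h : Fin s → MvPolynomial (Fin n) K,
        (∀ i, GITFan.IsPushForward P (GITFan.toLaurent (g i)) (GITFan.toLaurent (h i))) →
        GITFan.torusHom K P '' GITFan.torusZeros 𝔠 = GITFan.torusZerosPoly h ∧
        (GITFan.IsAFace 𝔞 γ₀ ↔ (GITFan.torusZerosPoly h).Nonempty) ∧
        (GITFan.IsAFace 𝔞 γ₀ ↔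
          (∏ j, MvPolynomial.X j) ∉ (Ideal.span (Set.range h)).radical)) ∧
    -- The algorithm: Hermite normal form `D = U * P_G`, whose upper non-zero rows form `P`, ...
    (∀ ν : Fin s → List (GITFan.faceIndex γ₀ → ℤ),
      (∀ i, GITFan.IsTermList (GITFan.toLaurent (g i)) (ν i)) →
      (∃ (n : ℕ) (hn : n ≤ GITFan.rowCount ν)
          (U : Matrix (Fin (GITFan.rowCount ν)) (Fin (GITFan.rowCount ν)) ℤ)
          (D : Matrix (Fin (GITFan.rowCount ν)) (GITFan.faceIndex γ₀) ℤ),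
        IsUnit U.det ∧ D = U * GITFan.stackMatrix ν ∧ GITFan.IsHermiteNormalForm hn D) ∧
      ∀ (n : ℕ) (hn : n ≤ GITFan.rowCount ν)
          (U : Matrix (Fin (GITFan.rowCount ν)) (Fin (GITFan.rowCount ν)) ℤ)
          (D : Matrix (Fin (GITFan.rowCount ν)) (GITFan.faceIndex γ₀) ℤ),
        IsUnit U.det → D = U * GITFan.stackMatrix ν → GITFan.IsHermiteNormalForm hn D →
        ∀ P : Matrix (Fin n) (GITFan.faceIndex γ₀) ℤ, P = GITFan.upperRows hn D →
          -- ... describes the quotient by the largest subgroup for which all `g i` are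
          -- homogeneous; this is `H(γ₀)` as soon as the `g i` are homogeneous for `H(γ₀)`.
          LinearIndependent ℤ P.row ∧
          (∀ t, t ∈ (GITFan.torusHom K P).ker ↔
            ∀ i, GITFan.IsSemiInvariant t (GITFan.toLaurent (g i))) ∧
          (GITFan.torusHom K P).ker ≤ H ∧
          ((∀ t ∈ H, ∀ i, GITFan.IsSemiInvariant t (GITFan.toLaurent (g i))) →
            GITFan.DescribesQuotient P H) ∧
          -- Smith normal form of `P`, ...
          (∃ U' V' D' σ, GITFan.IsSmithData P U' V' D' σ) ∧
          ∀ U' V' D' σ, GITFan.IsSmithData P U' V' D' σ →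
            -- ... integral matrices `B i = P_{g_i} V σ U`, ...
            ∃ B : ∀ i, Matrix (Fin ((ν i).length - 1)) (Fin n) ℤ,
              (∀ i, GITFan.ratMatrix (B i) =
                GITFan.ratMatrix (GITFan.diffMatrix (ν i)) * GITFan.ratMatrix V' * σ *
                  GITFan.ratMatrix U') ∧
              -- ... the push-forwards are polynomials after multiplication by a monomial, ...
              (∃ (μ : Fin s → Fin n → ℕ) (h : Fin s → MvPolynomial (Fin n) K),
                ∀ i, GITFan.toLaurent (h i) = AddMonoidAlgebra.single (fun j => (μ i j : ℤ)) 1 *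
                  GITFan.pushTerms (GITFan.toLaurent (g i)) (ν i) (B i)) ∧
              -- ... and every outcome of the test is correct.
              ∀ (μ : Fin s → Fin n → ℕ) (h : Fin s → MvPolynomial (Fin n) K),
                (∀ i, GITFan.toLaurent (h i) = AddMonoidAlgebra.single (fun j => (μ i j : ℤ)) 1 *
                  GITFan.pushTerms (GITFan.toLaurent (g i)) (ν i) (B i)) →
                (∀ i, GITFan.IsPushForward P (GITFan.toLaurent (g i))
                  (GITFan.toLaurent (h i))) ∧
                GITFan.torusHom K P '' GITFan.torusZeros 𝔠 = GITFan.torusZerosPoly h ∧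
                (GITFan.IsAFace 𝔞 γ₀ ↔ (GITFan.torusZerosPoly h).Nonempty) ∧
                (GITFan.IsAFace 𝔞 γ₀ ↔
                  (∏ j, MvPolynomial.X j) ∉ (Ideal.span (Set.range h)).radical)) := by
  classical
  have hgens : 𝔠 = Ideal.span (Set.range fun i => GITFan.toLaurent (g i)) := by
    simp only [h𝔠, h𝔞, GITFan.faceLaurentIdeal_span, hg]
  have hface : GITFan.IsAFace 𝔞 γ₀ ↔ (GITFan.torusZeros 𝔠).Nonempty := by
    rw [h𝔠, GITFan.isAFace_iff_nonempty]
  have htest : ∀ (n : ℕ) (P : Matrix (Fin n) (GITFan.faceIndex γ₀) ℤ),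
      LinearIndependent ℤ P.row → ∀ h : Fin s → MvPolynomial (Fin n) K,
      (∀ i, GITFan.IsPushForward P (GITFan.toLaurent (g i)) (GITFan.toLaurent (h i))) →
      GITFan.torusHom K P '' GITFan.torusZeros 𝔠 = GITFan.torusZerosPoly h ∧
      (GITFan.IsAFace 𝔞 γ₀ ↔ (GITFan.torusZerosPoly h).Nonempty) ∧
      (GITFan.IsAFace 𝔞 γ₀ ↔
        (∏ j, MvPolynomial.X j) ∉ (Ideal.span (Set.range h)).radical) := by
    intro n P hP h hh
    have h1 : GITFan.torusHom K P '' GITFan.torusZeros 𝔠 = GITFan.torusZerosPoly h := by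
      rw [hgens]
      exact GITFan.image_torusZeros_eq_torusZerosPoly _ P hP h hh
    have h2 : GITFan.IsAFace 𝔞 γ₀ ↔ (GITFan.torusZerosPoly h).Nonempty := by
      rw [hface, ← h1, Set.image_nonempty]
    exact ⟨h1, h2, h2.trans (GITFan.torusZerosPoly_nonempty_iff h)⟩
  refine ⟨hH ▸ GITFan.exists_describesQuotient 𝔠, fun n P hP => ?_, fun ν hν => ?_⟩
  · have h1 := GITFan.image_torusZeros_eq_pushIdeal 𝔠 P hP.full_rank (by rw [hP.ker_eq, hH])
    exact ⟨h1, by rw [hface, ← h1, Set.image_nonempty], htest n P hP.full_rank⟩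
  refine ⟨GITFan.exists_isHermiteNormalForm _, fun n hn U D hU hD hherm P hP => ?_⟩
  have hrank : LinearIndependent ℤ P.row := hP ▸ hherm.linearIndependent
  obtain ⟨C, W, hC, hW⟩ := hherm.exists_factorizations hU hD
  rw [← hP] at hC hW
  have hker : ∀ t, t ∈ (GITFan.torusHom K P).ker ↔
      ∀ i, GITFan.IsSemiInvariant t (GITFan.toLaurent (g i)) := by
    intro t
    simp only [GITFan.isSemiInvariant_iff_diffMatrix (hν _)]
    rw [← GITFan.mem_ker_torusHom_stackMatrix]
    exact ⟨fun h => GITFan.ker_torusHom_le_of_factor hC h,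
      fun h => GITFan.ker_torusHom_le_of_factor hW h⟩
  have hle : (GITFan.torusHom K P).ker ≤ H := by
    intro t ht
    rw [hH, hgens]
    exact GITFan.mem_maxInvariantSubgroup_of_isSemiInvariant _ ((hker t).1 ht)
  refine ⟨hrank, hker, hle, fun hhom => ⟨hrank, le_antisymm hle fun t ht => (hker t).2 (hhom t ht)⟩,
    GITFan.exists_isSmithData P hrank, fun U' V' D' σ hS => ?_⟩
  -- These `B i` do not depend on the Smith data. As `V' σ U'` is a section of `P`, multiplying
  -- `P_{g_i} = B_i P` by it gives the required formula for any choice.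
  choose B hB using GITFan.exists_diffMatrix_eq_mul hC
  refine ⟨B, fun i => ?_, ?_, fun μ h hh => ?_⟩
  · have h1 := hS.section_of
    simp only [Matrix.mul_assoc] at h1
    simp only [hB, GITFan.ratMatrix_mul, Matrix.mul_assoc, h1, Matrix.mul_one]
  · choose μ h hh using fun i => GITFan.exists_monomial_mul_eq_toLaurent
      (GITFan.pushTerms (GITFan.toLaurent (g i)) (ν i) (B i))
    refine ⟨μ, h, fun i => ?_⟩
    convert hh i
  · have hpush : ∀ i, GITFan.IsPushForward P (GITFan.toLaurent (g i))
        (GITFan.toLaurent (h i)) := fun i => by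
      rw [hh i]
      exact GITFan.isPushForward_pushTerms (hν i) (hB i) _
    exact ⟨hpush, htest n P hrank h hpush⟩
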